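/- Let $\varphi(x)=(1+x)\log(1+x)-x$. For a finite (simple) hypergraph $\mathcal H$ write $v(\mathcal H)$ for its number of vertices and $\Delta_q(\mathcal H)$ for the maximum, over all sets $U$ of $q$ vertices, of the number of edges of $\mathcal H$ containing $U$. Let $\mathcal H_p=\mathcal H[V_p(\mathcal H)]$, where $V_p(\mathcal H)$ contains each vertex independently with probability $p\in[0,1]$, and, for an integer $0\le m\le v(\mathcal H)$, let $\mathcal H_m=\mathcal H[V_m(\mathcal H)]$, where $V_m(\mathcal H)$ is a uniformly random set of exactly $m$ vertices. For non-negative edge weights $(w_f)_{f\in\mathcal H}$ and $\mathcal G\subseteq\mathcal H$ put $w(\mathcal G)=\sum_{f\in\mathcal G}w_f$. **Theorem.** For every integer $q\ge1$ there is a constant $d=d(q)\ge 1$, and for all integers $k\ge 2$ and reals $D,L,\sigma,\Lambda>0$ there is a constant $c=c(\sigma,\Lambda,k,D,L)>0$, such that the following holds for every integer $1\le q\le k$ and every real $N\ge1$. Let $\mathcal H$ be a finite $k$-uniform hypergraph with $v(\mathcal H)\le N$ and $\Delta_q(\mathcal H)\le D$, with edge weights $0\le w_f\le L$ for all $f\in\mathcal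 H$. Let $p\in[0,1]$ with $p\le \Lambda N^{-(q-1)/(k-1)-\sigma}$, and set $X=w(\mathcal H_p)$ and $\mu=\mathbb E X$. Then for all $t>0$, $$\mathbb P(X\ge\mu+t)\le d\exp\Bigl(-c\min\bigl\{\varphi(t/\mu)\,\mu,\;t^{1/q}\log N\bigr\}\Bigr),$$ where for $\mu=0$ the term $\varphi(t/\mu)\mu$ is read as its limit $+\infty$. Furthermore, if $0\le m\le v(\mathcal H)$ is an integer such that $p=m/v(\mathcal H)$ (with $p=0$ if $v(\mathcal H)=0$) satisfies $p\le \Lambda N^{-(q-1)/(k-1)-\sigma}$, then the same inequality, with the same $c$ and $d$, holds for all $t>0$ for $X=w(\mathcal H_m)$ and $\mu=\mathbb E\, w(\mathcal H_m)$. -/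

import Mathlib

open MeasureTheory ProbabilityTheory

namespace RandomHypergraph

/-- Every edge of `H` has exactly `k` vertices. -/
def IsUniform {α : Type*} (H : Hypergraph α) (k : ℕ) : Prop :=
  ∀ f ∈ H.edgeSet, f.ncard = k

/-- The set `Γ_U(H)` of all edges of `H` that contain the vertex set `U`. -/
def edgesContaining {α : Type*} (H : Hypergraph α) (U : Set α) : Set (Set α) :=
  {f | f ∈ H.edgeSet ∧ U ⊆ f}

/-- `Δ_j(H)`: the maximum, over all `j`-element vertex sets `U`, of the number of edges that
contain `U` (it is `0` if there is no such `U`). Used for finite `α` only. -/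
noncomputable def maxDegree {α : Type*} (H : Hypergraph α) (j : ℕ) : ℕ :=
  ⨆ U : {U : Set α // U ⊆ H.vertexSet ∧ U.ncard = j}, (edgesContaining H U.1).ncard

/-- The subhypergraph `H[S]` induced by the vertex set `S`. -/
def induce {α : Type*} (H : Hypergraph α) (S : Set α) : Hypergraph α where
  vertexSet := H.vertexSet ∩ S
  edgeSet := {f | f ∈ H.edgeSet ∧ f ⊆ S}
  subset_vertexSet_of_mem_edgeSet' := fun _ hf =>
    Set.subset_inter (H.subset_vertexSet_of_mem_edgeSet' hf.1) hf.2

/-- The total weight `w(G)` of all edges of `G`. Used for finite `α` only. -/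
noncomputable def totalWeight {α : Type*} (w : Set α → ℝ) (G : Hypergraph α) : ℝ :=
  ∑ᶠ f ∈ G.edgeSet, w f

/-- The law of the binomial random vertex set `V_p(H)`: every vertex of `H` is included
independently with probability `p`. -/
noncomputable def binomialLaw {α : Type*} (H : Hypergraph α) (p : unitInterval) :
    Measure (Set α) :=
  setBernoulli H.vertexSet p

/-- The law of the uniform random vertex set `V_m(H)`: a uniformly chosen set of exactly `m`
vertices of `H`. -/
noncomputable def uniformLaw {α : Type*} (H : Hypergraph α) (m : ℕ) : Measure (Set α) :=
  uniformOn {S : Set α | S ⊆ H.vertexSet ∧ S.ncard = m}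

/-- `φ(x) = (1 + x) log (1 + x) - x`. -/
noncomputable def phi (x : ℝ) : ℝ := (1 + x) * Real.log (1 + x) - x

/-- The rate `min {φ(t/μ) μ, t^(1/q) log N}`. For `μ = 0` the first term is read as its limit
`+∞` as `μ ↓ 0` (with `t > 0` fixed), so that the minimum is the second term. -/
noncomputable def tailRate (q : ℕ) (N μ t : ℝ) : ℝ :=
  if μ = 0 then t ^ (1 / (q : ℝ)) * Real.log N
  else min (phi (t / μ) * μ) (t ^ (1 / (q : ℝ)) * Real.log N)

/-- The bound `P(X ≥ μ + t) ≤ d exp (-c min {φ(t/μ) μ, t^(1/q) log N})` for all `t > 0`, where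
`X = w(H[S])` with `S` a random vertex set of law `P`, and `μ = E X`. -/
def UpperTailBound {α : Type*} (H : Hypergraph α) (w : Set α → ℝ) (P : Measure (Set α))
    (q : ℕ) (N c d : ℝ) : Prop :=
  ∀ t : ℝ, 0 < t →
    P.real {S | (∫ T, totalWeight w (induce H T) ∂P) + t ≤ totalWeight w (induce H S)} ≤
      d * Real.exp (-(c * tailRate q N (∫ T, totalWeight w (induce H T) ∂P) t))

end RandomHypergraph

/-! The two terms of the rate come from two obstructions. If each edge of a family `J` meets edges
of total weight at most `κ`, then weight `μ + 2t` forces many sequences of about `t / κ` pairwise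
disjoint edges. Negative correlation bounds the mean weight of such sequences by a power of `μ`, and
Markov's inequality gives the `φ` term (`IsSpread.prob_sparse_subfamily_le`).

Only degrees of `q`-sets are bounded, so a vertex may have large degree in the random hypergraph.
Large degrees force stars: edges through a common core of fewer than `q` vertices, disjoint outside
it. The bound on `p` makes the expected number of petals on a fixed core at most `N ^ (-(σ / 2))`,
so each petal costs a power of `N`. With `s` of order `t ^ (1 / q)`, both `s + 1` disjoint stars of
constant size and a single star with more than `r + s` petals have probability `exp (-Ω(s + 1) log
N)`.

Outside these two events, `O(s)` vertices meet all constant-size stars, and every vertex has degree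
`O((r + s) ^ (q - 1))`. Deleting the edges at those vertices costs weight `O(s ^ q)`, at most `t /
2`, and leaves bounded degrees (`exists_sparse_subfamily`), so the first argument applies. Both
random sets enter only through `IsSpread`. Bounded `N` is absorbed by the constant `c`. -/

namespace RandomHypergraph

/-! ### Disjoint subfamilies: union bounds, hitting sets and moments. -/

section DisjointFamilies

variable {α : Type*} [DecidableEq α]

/-- The unions of `r` pairwise disjoint members of `F`. -/
def disjointUnions : ℕ → Finset (Finset α) → Finset (Finset α)
  | 0, _ => {∅}
  | r + 1, F => F.biUnion fun f =>
      (disjointUnions r (F.filter fun g => Disjoint f g)).image fun A => f ∪ A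

theorem mem_disjointUnions_succ {r : ℕ} {F : Finset (Finset α)} {A : Finset α} :
    A ∈ disjointUnions (r + 1) F ↔
      ∃ f ∈ F, ∃ B ∈ disjointUnions r (F.filter fun g => Disjoint f g), f ∪ B = A := by
  simp [disjointUnions]

theorem disjointUnions_mono {r : ℕ} {F G : Finset (Finset α)} (h : F ⊆ G) :
    disjointUnions r F ⊆ disjointUnions r G := by
  induction r generalizing F G with
  | zero => simp [disjointUnions]
  | succ r ih =>
    intro A hA
    obtain ⟨f, hf, B, hB, rfl⟩ := mem_disjointUnions_succ.1 hA
    exact mem_disjointUnions_succ.2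
      ⟨f, h hf, B, ih (Finset.filter_subset_filter _ h) hB, rfl⟩

theorem subset_of_mem_disjointUnions {r : ℕ} {F : Finset (Finset α)} {T : Set α}
    (hF : ∀ f ∈ F, (f : Set α) ⊆ T) {A : Finset α} (hA : A ∈ disjointUnions r F) :
    (A : Set α) ⊆ T := by
  induction r generalizing F A with
  | zero => simp_all [disjointUnions]
  | succ r ih =>
    obtain ⟨f, hf, B, hB, rfl⟩ := mem_disjointUnions_succ.1 hA
    rw [Finset.coe_union]
    exact Set.union_subset (hF f hf) (ih (fun g hg => hF g (Finset.mem_of_mem_filter _ hg)) hB)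

theorem card_le_of_mem_disjointUnions {r b : ℕ} {F : Finset (Finset α)}
    (hF : ∀ f ∈ F, f.card ≤ b) {A : Finset α} (hA : A ∈ disjointUnions r F) :
    A.card ≤ r * b := by
  induction r generalizing F A with
  | zero => simp_all [disjointUnions]
  | succ r ih =>
    obtain ⟨f, hf, B, hB, rfl⟩ := mem_disjointUnions_succ.1 hA
    have h1 := ih (fun g hg => hF g (Finset.mem_of_mem_filter _ hg)) hB
    have h2 := hF f hf
    have h3 := Finset.card_union_le f B
    rw [Nat.succ_mul]
    omega

theorem sum_biUnion_le_sum {ι β : Type*} [DecidableEq β] (s : Finset ι) (t : ι → Finset β)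
    {g : β → ℝ} (hg : ∀ x, 0 ≤ g x) :
    ∑ x ∈ s.biUnion t, g x ≤ ∑ i ∈ s, ∑ x ∈ t i, g x := by
  classical
  induction s using Finset.induction_on with
  | empty => simp
  | insert a s ha ih =>
    rw [Finset.biUnion_insert, Finset.sum_insert ha]
    have := Finset.sum_union_inter (s₁ := t a) (s₂ := s.biUnion t) (f := g)
    have h0 : 0 ≤ ∑ x ∈ t a ∩ s.biUnion t, g x := Finset.sum_nonneg fun x _ => hg x
    linarith

theorem sum_image_le_sum {ι β : Type*} [DecidableEq β] (s : Finset ι) (t : ι → β)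
    {g : β → ℝ} (hg : ∀ x, 0 ≤ g x) :
    ∑ x ∈ s.image t, g x ≤ ∑ i ∈ s, g (t i) := by
  have h := sum_biUnion_le_sum s (fun i => {t i}) hg
  simpa [Finset.biUnion_singleton] using h

/-- Disjointness makes `p ^ card` multiplicative over the members, so expanding the power on the
right counts every union at least once. -/
theorem sum_pow_card_disjointUnions_le {p : ℝ} (hp : 0 ≤ p) (r : ℕ) (F : Finset (Finset α)) :
    ∑ A ∈ disjointUnions r F, p ^ A.card ≤ (∑ f ∈ F, p ^ f.card) ^ r := by
  induction r generalizing F with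
  | zero => simp [disjointUnions]
  | succ r ih =>
    calc ∑ A ∈ disjointUnions (r + 1) F, p ^ A.card
        ≤ ∑ f ∈ F, ∑ A ∈ (disjointUnions r (F.filter fun g => Disjoint f g)).image
            (fun A => f ∪ A), p ^ A.card := sum_biUnion_le_sum _ _ fun _ => pow_nonneg hp _
      _ ≤ ∑ f ∈ F, ∑ A ∈ disjointUnions r (F.filter fun g => Disjoint f g),
            p ^ (f ∪ A).card :=
          Finset.sum_le_sum fun f _ => sum_image_le_sum _ _ fun _ => pow_nonneg hp _
      _ = ∑ f ∈ F, ∑ A ∈ disjointUnions r (F.filter fun g => Disjoint f g),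
            p ^ f.card * p ^ A.card := by
          refine Finset.sum_congr rfl fun f _ => Finset.sum_congr rfl fun A hA => ?_
          rw [← pow_add, Finset.card_union_of_disjoint]
          have : (A : Set α) ⊆ (f : Set α)ᶜ := by
            refine subset_of_mem_disjointUnions (fun g hg => ?_) hA
            rw [Set.subset_compl_iff_disjoint_left]
            exact_mod_cast (Finset.mem_filter.1 hg).2
          rw [Set.subset_compl_iff_disjoint_left] at this
          exact_mod_cast this
      _ = ∑ f ∈ F, p ^ f.card *
            ∑ A ∈ disjointUnions r (F.filter fun g => Disjoint f g), p ^ A.card := by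
          simp_rw [Finset.mul_sum]
      _ ≤ ∑ f ∈ F, p ^ f.card * (∑ f ∈ F, p ^ f.card) ^ r := by
          refine Finset.sum_le_sum fun f _ => mul_le_mul_of_nonneg_left ?_ (pow_nonneg hp _)
          refine (ih _).trans (pow_le_pow_left₀ (Finset.sum_nonneg fun _ _ => pow_nonneg hp _) ?_ r)
          exact Finset.sum_le_sum_of_subset_of_nonneg (Finset.filter_subset _ _)
            fun _ _ _ => pow_nonneg hp _
      _ = _ := by rw [← Finset.sum_mul, pow_succ']

/-- If `F` has no `r + 1` pairwise disjoint members, then some small set meets every member. -/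
theorem exists_hitting_set {r b : ℕ} {F : Finset (Finset α)} (hb : ∀ f ∈ F, f.card ≤ b)
    (h0 : ∀ f ∈ F, f.Nonempty) (hF : disjointUnions (r + 1) F = ∅) :
    ∃ W : Finset α, W.card ≤ r * b ∧ (∀ f ∈ F, ¬ Disjoint f W) := by
  induction r generalizing F with
  | zero =>
    have : F = ∅ := by
      by_contra h
      obtain ⟨f, hf⟩ := Finset.nonempty_of_ne_empty h
      have : f ∪ ∅ ∈ disjointUnions (0 + 1) F :=
        mem_disjointUnions_succ.2 ⟨f, hf, ∅, by simp [disjointUnions], rfl⟩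
      simp [hF] at this
    exact ⟨∅, by simp [this]⟩
  | succ r ih =>
    rcases F.eq_empty_or_nonempty with rfl | ⟨f, hf⟩
    · exact ⟨∅, by simp⟩
    -- Greedy choice: members missing `f` have one fewer disjoint member available, and `f` itself
    -- hits all the others.
    · have hF' : disjointUnions (r + 1) (F.filter fun g => Disjoint f g) = ∅ := by
        by_contra h
        obtain ⟨B, hB⟩ := Finset.nonempty_of_ne_empty h
        have := mem_disjointUnions_succ.2 ⟨f, hf, B, hB, rfl⟩
        simp [hF] at this
      obtain ⟨W, hW, hit⟩ := ih (fun g hg => hb g (Finset.mem_of_mem_filter _ hg))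
        (fun g hg => h0 g (Finset.mem_of_mem_filter _ hg)) hF'
      refine ⟨f ∪ W, ?_, fun g hg hd => ?_⟩
      · have h1 := Finset.card_union_le f W
        have h2 := hb f hf
        rw [Nat.succ_mul]
        omega
      · rw [Finset.disjoint_union_right] at hd
        exact hit g (Finset.mem_filter.2 ⟨hg, hd.1.symm⟩) hd.2

/-- The sum of `∏ w fᵢ` over all sequences of `r` pairwise disjoint members of `F`. -/
def disjointMoment (w : Finset α → ℝ) : ℕ → Finset (Finset α) → ℝ
  | 0, _ => 1
  | r + 1, F => ∑ f ∈ F, w f * disjointMoment w r (F.filter fun g => Disjoint f g)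

theorem disjointMoment_nonneg {w : Finset α → ℝ} (hw : ∀ f, 0 ≤ w f) (r : ℕ)
    (F : Finset (Finset α)) : 0 ≤ disjointMoment w r F := by
  induction r generalizing F with
  | zero => simp [disjointMoment]
  | succ r ih => exact Finset.sum_nonneg fun f _ => mul_nonneg (hw f) (ih _)

theorem disjointMoment_mono {w : Finset α → ℝ} (hw : ∀ f, 0 ≤ w f) (r : ℕ)
    {F G : Finset (Finset α)} (h : F ⊆ G) : disjointMoment w r F ≤ disjointMoment w r G := by
  induction r generalizing F G with
  | zero => simp [disjointMoment]
  | succ r ih =>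
    calc disjointMoment w (r + 1) F
        ≤ ∑ f ∈ F, w f * disjointMoment w r (G.filter fun g => Disjoint f g) :=
          Finset.sum_le_sum fun f _ =>
            mul_le_mul_of_nonneg_left (ih (Finset.filter_subset_filter _ h)) (hw f)
      _ ≤ _ := Finset.sum_le_sum_of_subset_of_nonneg h fun f _ _ =>
          mul_nonneg (hw f) (disjointMoment_nonneg hw _ _)

/-- Each chosen member excludes weight at most `κ`, so after at most `r - 1` choices weight at least
`a` is still available for the next one. -/
theorem pow_le_disjointMoment {w : Finset α → ℝ} (hw : ∀ f, 0 ≤ w f) {a κ : ℝ} (ha : 0 ≤ a)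
    (hκ : 0 ≤ κ) (r : ℕ) {F : Finset (Finset α)}
    (hF : ∀ f ∈ F, ∑ g ∈ F.filter (fun g => ¬ Disjoint f g), w g ≤ κ)
    (hwF : a + (r - 1) * κ ≤ ∑ f ∈ F, w f) (hr : 1 ≤ r) : a ^ r ≤ disjointMoment w r F := by
  induction r, hr using Nat.le_induction generalizing F with
  | base => simpa [disjointMoment] using hwF
  | succ r hr ih =>
    have hr1 : (1 : ℝ) ≤ r := by exact_mod_cast hr
    push_cast at hwF
    have h1 : ∀ f ∈ F, a ^ r ≤ disjointMoment w r (F.filter fun g => Disjoint f g) := by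
      intro f hf
      refine ih (fun g hg => (Finset.sum_le_sum_of_subset_of_nonneg
        (Finset.filter_subset_filter _ (Finset.filter_subset _ _)) fun _ _ _ => hw _).trans
        (hF g (Finset.mem_of_mem_filter _ hg))) ?_
      have := Finset.sum_filter_add_sum_filter_not F (fun g => Disjoint f g) w
      have := hF f hf
      linarith
    calc a ^ (r + 1) = a * a ^ r := pow_succ' _ _
      _ ≤ (∑ f ∈ F, w f) * a ^ r := by
          refine mul_le_mul_of_nonneg_right ?_ (pow_nonneg ha _)
          nlinarith
      _ = ∑ f ∈ F, w f * a ^ r := Finset.sum_mul _ _ _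
      _ ≤ _ := Finset.sum_le_sum fun f hf => mul_le_mul_of_nonneg_left (h1 f hf) (hw f)

end DisjointFamilies

/-! ### Negatively correlated random sets and the moment bound for sparse families. -/

section SpreadLaws

variable {α : Type*}

/-- The vertices of a random set of law `P` have probability at most `p` each, and the events of
containing two disjoint sets are negatively correlated. -/
structure IsSpread (P : Measure (Set α)) (p : ℝ) : Prop where
  nonneg : 0 ≤ p
  le_one : p ≤ 1
  singleton_le : ∀ v, P.real {S | v ∈ S} ≤ p
  union_le : ∀ A B : Finset α, Disjoint A B →
    P.real {S | (A : Set α) ⊆ S ∧ (B : Set α) ⊆ S} ≤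
      P.real {S | (A : Set α) ⊆ S} * P.real {S | (B : Set α) ⊆ S}

open Classical in
/-- The members of `F` that are contained in `S`. -/
noncomputable def membersWithin (F : Finset (Finset α)) (S : Set α) : Finset (Finset α) :=
  F.filter fun f => (f : Set α) ⊆ S

theorem mem_membersWithin {F : Finset (Finset α)} {S : Set α} {f : Finset α} :
    f ∈ membersWithin F S ↔ f ∈ F ∧ (f : Set α) ⊆ S := by
  simp [membersWithin]

theorem membersWithin_mono {F : Finset (Finset α)} {S T : Set α} (h : S ⊆ T) :
    membersWithin F S ⊆ membersWithin F T := by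
  intro f
  simp only [mem_membersWithin]
  exact fun hf => ⟨hf.1, hf.2.trans h⟩

theorem membersWithin_subset (F : Finset (Finset α)) (S : Set α) : membersWithin F S ⊆ F :=
  fun _ hf => (mem_membersWithin.1 hf).1

variable {P : Measure (Set α)} {p : ℝ}

theorem IsSpread.prob_subset_le [IsProbabilityMeasure P] (h : IsSpread P p) (A : Finset α) :
    P.real {S | (A : Set α) ⊆ S} ≤ p ^ A.card := by
  classical
  induction A using Finset.induction_on with
  | empty => simp
  | insert a A ha ih =>
    have h1 := h.union_le {a} A (by simpa using ha)
    have h2 : {S : Set α | ((insert a A : Finset α) : Set α) ⊆ S} =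
        {S | (({a} : Finset α) : Set α) ⊆ S ∧ (A : Set α) ⊆ S} := by
      ext S; simp [Set.insert_subset_iff]
    rw [h2, Finset.card_insert_of_notMem ha, pow_succ']
    refine h1.trans (mul_le_mul ?_ ih measureReal_nonneg h.nonneg)
    simpa using h.singleton_le a

theorem IsSpread.prob_exists_subset_le [IsProbabilityMeasure P] (h : IsSpread P p)
    (F : Finset (Finset α)) :
    P.real {S | ∃ A ∈ F, (A : Set α) ⊆ S} ≤ ∑ A ∈ F, p ^ A.card := by
  have h1 : {S : Set α | ∃ A ∈ F, (A : Set α) ⊆ S} = ⋃ A ∈ F, {S | (A : Set α) ⊆ S} := by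
    ext S; simp
  rw [h1]
  exact (measureReal_biUnion_finset_le _ _).trans
    (Finset.sum_le_sum fun A _ => h.prob_subset_le A)

/-- The mean `∑ f ∈ E, w f * P(f ⊆ S)`. -/
noncomputable def meanWeight (P : Measure (Set α)) (E : Finset (Finset α)) (w : Finset α → ℝ) :
    ℝ :=
  ∑ f ∈ E, w f * P.real {S | (f : Set α) ⊆ S}

theorem meanWeight_nonneg (P : Measure (Set α)) (E : Finset (Finset α)) {w : Finset α → ℝ}
    (hw : ∀ f, 0 ≤ w f) : 0 ≤ meanWeight P E w :=
  Finset.sum_nonneg fun f _ => mul_nonneg (hw f) measureReal_nonneg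

theorem integral_ite_eq [Finite α] [IsProbabilityMeasure P] (A : Finset α) (c : ℝ)
    [DecidablePred fun S : Set α => (A : Set α) ⊆ S] :
    ∫ S, (if (A : Set α) ⊆ S then c else 0) ∂P = c * P.real {S | (A : Set α) ⊆ S} := by
  have : (fun S : Set α => if (A : Set α) ⊆ S then c else 0) =
      Set.indicator {S | (A : Set α) ⊆ S} fun _ => c := by
    ext S; simp [Set.indicator_apply]
  rw [this, integral_indicator_const _ (Set.toFinite _).measurableSet, smul_eq_mul, mul_comm]

theorem integral_sum_membersWithin [Finite α] [IsProbabilityMeasure P] (E : Finset (Finset α))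
    (w : Finset α → ℝ) :
    ∫ S, ∑ f ∈ membersWithin E S, w f ∂P = meanWeight P E w := by
  classical
  have : ∀ S : Set α, ∑ f ∈ membersWithin E S, w f =
      ∑ f ∈ E, if (f : Set α) ⊆ S then w f else 0 := fun S => by
    rw [membersWithin, Finset.sum_filter]
  simp_rw [this]
  rw [integral_finsetSum _ fun _ _ => Integrable.of_finite]
  exact Finset.sum_congr rfl fun f _ => integral_ite_eq f (w f)

open Classical in
-- The set `A` holds the vertices of the edges already chosen. Carrying it along lets the induction
-- pull out one factor `P(f ⊆ S)` per edge, by negative correlation with `A ⊆ S`.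
theorem IsSpread.integral_disjointMoment_aux [Finite α] [IsProbabilityMeasure P]
    (h : IsSpread P p) (E : Finset (Finset α)) {w : Finset α → ℝ} (hw : ∀ f, 0 ≤ w f)
    (r : ℕ) (A : Finset α) :
    ∫ S, (if (A : Set α) ⊆ S then
        disjointMoment w r (membersWithin (E.filter fun g => Disjoint A g) S) else 0) ∂P ≤
      P.real {S | (A : Set α) ⊆ S} * meanWeight P E w ^ r := by
  induction r generalizing A with
  | zero => simp [disjointMoment, integral_ite_eq]
  | succ r ih =>
    have key : ∀ S : Set α, (if (A : Set α) ⊆ S then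
        disjointMoment w (r + 1) (membersWithin (E.filter fun g => Disjoint A g) S) else 0) =
        ∑ f ∈ E.filter (fun g => Disjoint A g), w f *
          (if ((A ∪ f : Finset α) : Set α) ⊆ S then
            disjointMoment w r (membersWithin (E.filter fun g => Disjoint (A ∪ f) g) S)
            else 0) := by
      intro S
      split_ifs with hA
      · rw [disjointMoment, membersWithin, Finset.sum_filter]
        refine Finset.sum_congr rfl fun f _ => ?_
        have h1 : ((A ∪ f : Finset α) : Set α) ⊆ S ↔ (f : Set α) ⊆ S := by
          simp [Set.union_subset_iff, hA]
        by_cases hf : (f : Set α) ⊆ S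
        · rw [if_pos hf, if_pos (h1.2 hf)]
          congr 2
          ext g
          simp only [mem_membersWithin, Finset.mem_filter, Finset.disjoint_union_left]
          tauto
        · rw [if_neg hf, if_neg (fun hh => hf (h1.1 hh)), mul_zero]
      · refine (Finset.sum_eq_zero fun f _ => ?_).symm
        rw [if_neg, mul_zero]
        intro hh
        exact hA ((Finset.coe_subset.2 Finset.subset_union_left).trans hh)
    simp_rw [key]
    rw [integral_finsetSum _ fun _ _ => Integrable.of_finite]
    simp_rw [integral_const_mul]
    have hμ := meanWeight_nonneg P E hw
    calc _ ≤ ∑ f ∈ E.filter (fun g => Disjoint A g), w f *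
          (P.real {S | (A : Set α) ⊆ S} * P.real {S | (f : Set α) ⊆ S} *
            meanWeight P E w ^ r) := by
          refine Finset.sum_le_sum fun f hf => mul_le_mul_of_nonneg_left ?_ (hw f)
          refine (ih (A ∪ f)).trans (mul_le_mul_of_nonneg_right ?_ (pow_nonneg hμ _))
          refine le_trans (le_of_eq ?_) (h.union_le A f (Finset.mem_filter.1 hf).2)
          congr 1
          ext S
          simp [Set.union_subset_iff]
      _ ≤ ∑ f ∈ E, w f *
          (P.real {S | (A : Set α) ⊆ S} * P.real {S | (f : Set α) ⊆ S} *
            meanWeight P E w ^ r) :=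
          Finset.sum_le_sum_of_subset_of_nonneg (Finset.filter_subset _ _) fun f _ _ =>
            mul_nonneg (hw f) (mul_nonneg (mul_nonneg measureReal_nonneg measureReal_nonneg)
              (pow_nonneg hμ _))
      _ = _ := by
          rw [pow_succ, meanWeight, Finset.mul_sum, Finset.mul_sum]
          exact Finset.sum_congr rfl fun f _ => by ring

theorem IsSpread.integral_disjointMoment_le [DecidableEq α] [Finite α] [IsProbabilityMeasure P]
    (h : IsSpread P p) (E : Finset (Finset α)) {w : Finset α → ℝ} (hw : ∀ f, 0 ≤ w f) (r : ℕ) :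
    ∫ S, disjointMoment w r (membersWithin E S) ∂P ≤ meanWeight P E w ^ r := by
  have := h.integral_disjointMoment_aux E hw r ∅
  simp only [Finset.coe_empty, Set.empty_subset, if_true, Finset.disjoint_empty_left,
    Finset.filter_true, Set.ofPred_true, probReal_univ, one_mul] at this
  convert this

/-- The upper tail bound for the weight of subfamilies in which every member meets members of total
weight at most `κ`. -/
theorem IsSpread.prob_sparse_subfamily_le [DecidableEq α] [Finite α] [IsProbabilityMeasure P]
    (h : IsSpread P p) (E : Finset (Finset α)) {w : Finset α → ℝ} (hw : ∀ f, 0 ≤ w f)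
    {κ t : ℝ} (hκ : 0 < κ) (ht : 0 < t) (hμ : 0 < meanWeight P E w) :
    P.real {S | ∃ J ⊆ membersWithin E S,
        (∀ f ∈ J, ∑ g ∈ J.filter (fun g => ¬ Disjoint f g), w g ≤ κ) ∧
        meanWeight P E w + 2 * t ≤ ∑ f ∈ J, w f} ≤
      Real.exp (-(t / κ * Real.log (1 + t / meanWeight P E w))) := by
  set μ := meanWeight P E w
  -- Rounding up gives the exponent at least `t / κ`, while `(r - 1) κ ≤ t` still leaves weight `μ +
  -- t` for every choice.
  set r := ⌈t / κ⌉₊ with hr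
  have hr1 : 1 ≤ r := Nat.one_le_ceil_iff.2 (div_pos ht hκ)
  have hr2 : ((r : ℝ) - 1) * κ ≤ t := by
    have := Nat.ceil_lt_add_one (div_pos ht hκ).le
    have h3 : (r : ℝ) - 1 ≤ t / κ := by linarith
    calc ((r : ℝ) - 1) * κ ≤ t / κ * κ := mul_le_mul_of_nonneg_right h3 hκ.le
      _ = t := div_mul_cancel₀ _ hκ.ne'
  have hsub : {S | ∃ J ⊆ membersWithin E S,
        (∀ f ∈ J, ∑ g ∈ J.filter (fun g => ¬ Disjoint f g), w g ≤ κ) ∧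
        μ + 2 * t ≤ ∑ f ∈ J, w f} ⊆
      {S | (μ + t) ^ r ≤ disjointMoment w r (membersWithin E S)} := by
    rintro S ⟨J, hJ, hJκ, hJw⟩
    exact (pow_le_disjointMoment hw (by positivity) hκ.le r hJκ (by linarith) hr1).trans
      (disjointMoment_mono hw r hJ)
  have hmk := mul_meas_ge_le_integral_of_nonneg (μ := P)
    (f := fun S => disjointMoment w r (membersWithin E S))
    (Filter.Eventually.of_forall fun S => disjointMoment_nonneg hw _ _) Integrable.of_finite
    ((μ + t) ^ r)
  have hle := (measureReal_mono (μ := P) hsub)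
  have hpos : 0 < (μ + t) ^ r := by positivity
  calc _ ≤ P.real {S | (μ + t) ^ r ≤ disjointMoment w r (membersWithin E S)} := hle
    _ ≤ μ ^ r / (μ + t) ^ r := by
        rw [le_div_iff₀ hpos, mul_comm]
        exact hmk.trans (h.integral_disjointMoment_le E hw r)
    _ = Real.exp (-(r * Real.log (1 + t / μ))) := by
        rw [← div_pow, ← mul_neg, Real.exp_nat_mul, ← Real.log_inv, Real.exp_log (by positivity)]
        congr 1
        field_simp
    _ ≤ _ := by
        refine Real.exp_le_exp.2 (neg_le_neg (mul_le_mul_of_nonneg_right (Nat.le_ceil _) ?_))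
        exact Real.log_nonneg (by have := div_pos ht hμ; linarith)

end SpreadLaws

/-! ### Stars, their expected number, and degrees in star-free families. -/

section Stars

variable {α : Type*} [DecidableEq α]

/-- The sets `f \ U`, where `f` is a member of `F` containing `U`. -/
def link (F : Finset (Finset α)) (U : Finset α) : Finset (Finset α) :=
  (F.filter fun f => U ⊆ f).image fun f => f \ U

/-- The vertex sets of the `r`-stars: unions of `r` members of `E` that contain a common core `U`
with `1 ≤ |U| < q` and are pairwise disjoint outside of `U`. -/
def stars (V : Finset α) (E : Finset (Finset α)) (q r : ℕ) : Finset (Finset α) :=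
  ((Finset.Ico 1 q).biUnion fun j => V.powersetCard j).biUnion fun U =>
    (disjointUnions r (link E U)).image fun A => U ∪ A

theorem mem_link {F : Finset (Finset α)} {U A : Finset α} :
    A ∈ link F U ↔ ∃ f ∈ F, U ⊆ f ∧ f \ U = A := by
  simp [link, and_assoc]

theorem mem_stars {V : Finset α} {E : Finset (Finset α)} {q r : ℕ} {A : Finset α} :
    A ∈ stars V E q r ↔ ∃ U ⊆ V, (1 ≤ U.card ∧ U.card < q) ∧
      ∃ B ∈ disjointUnions r (link E U), U ∪ B = A := by
  simp only [stars, Finset.mem_biUnion, Finset.mem_Ico, Finset.mem_powersetCard, Finset.mem_image]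
  constructor
  · rintro ⟨U, ⟨j, hj, hU, rfl⟩, h⟩
    exact ⟨U, hU, hj, h⟩
  · rintro ⟨U, hU, hj, h⟩
    exact ⟨U, ⟨_, hj, hU, rfl⟩, h⟩

theorem sum_pow_card_stars_le {V : Finset α} {E : Finset (Finset α)} {q r k : ℕ} {p a N : ℝ}
    (hp : 0 ≤ p) (hp1 : p ≤ 1) (hN : 1 ≤ N) (hV : (V.card : ℝ) ≤ N) (hE : ∀ f ∈ E, f.card = k)
    (hqk : q ≤ k)
    (ha0 : 0 ≤ a) (ha : ∀ U : Finset α, 1 ≤ U.card → U.card < q →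
      ((E.filter fun f => U ⊆ f).card : ℝ) * p ^ (k - U.card) ≤ a) :
    ∑ A ∈ stars V E q r, p ^ A.card ≤ k * N ^ k * a ^ r := by
  have hg : ∀ A : Finset α, 0 ≤ p ^ A.card := fun _ => pow_nonneg hp _
  have hUs : ∀ U : Finset α, 1 ≤ U.card → U.card < q →
      ∑ A ∈ (disjointUnions r (link E U)).image (fun A => U ∪ A), p ^ A.card ≤ a ^ r := by
    intro U hU1 hU2
    calc _ ≤ ∑ A ∈ disjointUnions r (link E U), p ^ (U ∪ A).card :=
          sum_image_le_sum _ (fun A => U ∪ A) (g := fun A => p ^ A.card) hg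
      -- The probability of the core is given away; only the petals are paid for.
      _ ≤ ∑ A ∈ disjointUnions r (link E U), p ^ A.card :=
          Finset.sum_le_sum fun A _ =>
            pow_le_pow_of_le_one hp hp1 (Finset.card_le_card Finset.subset_union_right)
      _ ≤ (∑ f ∈ link E U, p ^ f.card) ^ r := sum_pow_card_disjointUnions_le hp _ _
      _ ≤ a ^ r := by
          refine pow_le_pow_left₀ (Finset.sum_nonneg fun _ _ => hg _) ?_ r
          refine (sum_image_le_sum _ _ (g := fun A : Finset α => p ^ A.card) hg).trans (le_trans (le_of_eq ?_) (ha U hU1 hU2))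
          rw [← nsmul_eq_mul, ← Finset.sum_const]
          refine Finset.sum_congr rfl fun f hf => ?_
          rw [Finset.mem_filter] at hf
          rw [Finset.card_sdiff_of_subset hf.2, hE f hf.1]
  calc _ ≤ ∑ U ∈ (Finset.Ico 1 q).biUnion (fun j => V.powersetCard j),
        ∑ A ∈ (disjointUnions r (link E U)).image (fun A => U ∪ A), p ^ A.card :=
        sum_biUnion_le_sum _ _ hg
    _ ≤ ∑ j ∈ Finset.Ico 1 q, ∑ U ∈ V.powersetCard j,
        ∑ A ∈ (disjointUnions r (link E U)).image (fun A => U ∪ A), p ^ A.card :=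
        sum_biUnion_le_sum _ _ fun _ => Finset.sum_nonneg fun _ _ => hg _
    _ ≤ ∑ j ∈ Finset.Ico 1 q, N ^ k * a ^ r := by
        refine Finset.sum_le_sum fun j hj => ?_
        rw [Finset.mem_Ico] at hj
        calc _ ≤ ∑ U ∈ V.powersetCard j, a ^ r := by
              refine Finset.sum_le_sum fun U hU => ?_
              rw [Finset.mem_powersetCard] at hU
              exact hUs U (by omega) (by omega)
          _ = (V.powersetCard j).card * a ^ r := by rw [Finset.sum_const, nsmul_eq_mul]
          _ ≤ N ^ k * a ^ r := by
              refine mul_le_mul_of_nonneg_right ?_ (pow_nonneg ha0 _)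
              rw [Finset.card_powersetCard]
              calc ((V.card.choose j : ℕ) : ℝ) ≤ (V.card : ℝ) ^ j := by
                    exact_mod_cast Nat.choose_le_pow _ _
                _ ≤ N ^ j := pow_le_pow_left₀ (Nat.cast_nonneg _) hV _
                _ ≤ N ^ k := pow_le_pow_right₀ hN (by omega)
    _ ≤ k * N ^ k * a ^ r := by
        rw [Finset.sum_const, nsmul_eq_mul, Nat.card_Ico, mul_assoc]
        refine mul_le_mul_of_nonneg_right ?_ (by positivity)
        exact_mod_cast (Nat.sub_le _ _).trans hqk

/-- If every set `U` with `j ≤ |U| < q` has a set of at most `M` vertices that meets `f \ U` for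
all members `f` containing `U`, then degrees of small sets are bounded by those of `q`-sets. -/
theorem card_filter_superset_le {F : Finset (Finset α)} {q j : ℕ} {D M : ℝ}
    (hD : ∀ U : Finset α, U.card = q → ((F.filter fun f => U ⊆ f).card : ℝ) ≤ D)
    (hZ : ∀ U : Finset α, j ≤ U.card → U.card < q → ∃ Z : Finset α, (Z.card : ℝ) ≤ M ∧
      ∀ f ∈ F, U ⊆ f → ∃ v ∈ Z, v ∈ f ∧ v ∉ U) (hD0 : 0 ≤ D) (hM : 0 ≤ M)
    (U : Finset α) (hjU : j ≤ U.card) (hUq : U.card ≤ q) :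
    ((F.filter fun f => U ⊆ f).card : ℝ) ≤ D * M ^ (q - U.card) := by
  induction hi : q - U.card generalizing U with
  | zero => simpa using hD U (by omega)
  | succ i ih =>
    obtain ⟨Z, hZc, hZ⟩ := hZ U hjU (by omega)
    have hsub : (F.filter fun f => U ⊆ f) ⊆
        (Z \ U).biUnion fun v => F.filter fun f => insert v U ⊆ f := by
      intro f hf
      rw [Finset.mem_filter] at hf
      obtain ⟨v, hv, hvf, hvU⟩ := hZ f hf.1 hf.2
      exact Finset.mem_biUnion.2 ⟨v, Finset.mem_sdiff.2 ⟨hv, hvU⟩,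
        Finset.mem_filter.2 ⟨hf.1, Finset.insert_subset hvf hf.2⟩⟩
    calc ((F.filter fun f => U ⊆ f).card : ℝ)
        ≤ ∑ v ∈ Z \ U, ((F.filter fun f => insert v U ⊆ f).card : ℝ) := by
          exact_mod_cast (Finset.card_le_card hsub).trans Finset.card_biUnion_le
      _ ≤ ∑ v ∈ Z \ U, D * M ^ i := by
          refine Finset.sum_le_sum fun v hv => ?_
          have hc := Finset.card_insert_of_notMem (Finset.mem_sdiff.1 hv).2
          exact ih (insert v U) (by omega) (by omega) (by omega)
      _ = (Z \ U).card * (D * M ^ i) := by rw [Finset.sum_const, nsmul_eq_mul]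
      _ ≤ M * (D * M ^ i) := by
          refine mul_le_mul_of_nonneg_right (le_trans ?_ hZc) (by positivity)
          exact_mod_cast Finset.card_le_card Finset.sdiff_subset
      _ = D * M ^ (i + 1) := by ring

theorem card_filter_superset_le_pow {V : Finset α} {E : Finset (Finset α)} {q k : ℕ} {D N : ℝ}
    (hE : ∀ f ∈ E, f ⊆ V ∧ f.card = k) (hqk : q ≤ k) (hV : (V.card : ℝ) ≤ N)
    (hD : ∀ U : Finset α, U.card = q → ((E.filter fun f => U ⊆ f).card : ℝ) ≤ D) (hD0 : 0 ≤ D)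
    (U : Finset α) (hUq : U.card ≤ q) :
    ((E.filter fun f => U ⊆ f).card : ℝ) ≤ D * N ^ (q - U.card) := by
  -- The whole vertex set serves as `Z`, since an edge containing `U` has more than `|U|` vertices.
  refine card_filter_superset_le (j := 0) hD (fun U _ hU => ⟨V, hV, fun f hf hUf => ?_⟩) hD0
    ((Nat.cast_nonneg _).trans hV) U (Nat.zero_le _) hUq
  obtain ⟨v, hv, hvU⟩ := Finset.exists_mem_notMem_of_card_lt_card
    (show U.card < f.card by rw [(hE f hf).2]; omega)
  exact ⟨v, (hE f hf).1 hv, hv, hvU⟩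

/-- A family without large stars has bounded degrees. -/
theorem card_filter_superset_le_of_stars {V : Finset α} {E : Finset (Finset α)} {q k r : ℕ}
    {D : ℝ} (hE : ∀ f ∈ E, f ⊆ V ∧ f.card = k) (hqk : q ≤ k)
    (hD : ∀ U : Finset α, U.card = q → ((E.filter fun f => U ⊆ f).card : ℝ) ≤ D) (hD0 : 0 ≤ D)
    {T : Set α} (hT : ∀ A ∈ stars V E q (r + 1), ¬ (A : Set α) ⊆ T)
    (U : Finset α) (hU1 : 1 ≤ U.card) (hUq : U.card ≤ q) :
    (((membersWithin E T).filter fun f => U ⊆ f).card : ℝ) ≤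
      D * ((r * k : ℕ) : ℝ) ^ (q - U.card) := by
  refine card_filter_superset_le (j := 1) (fun U hU => ?_) (fun U h1 hU => ?_) hD0
    (Nat.cast_nonneg _) U hU1 hUq
  · refine le_trans ?_ (hD U hU)
    exact_mod_cast Finset.card_le_card (Finset.filter_subset_filter _ (membersWithin_subset _ _))
  -- A member containing `U` ensures that the core lies in `V` and `T`, so disjoint petals would
  -- form a forbidden star inside `T`. Without such a member, `Z = ∅` works.
  · by_cases hne : ∃ f ∈ membersWithin E T, U ⊆ f
    · obtain ⟨f₀, hf₀, hUf₀⟩ := hne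
      rw [mem_membersWithin] at hf₀
      have hUT : (U : Set α) ⊆ T := (Finset.coe_subset.2 hUf₀).trans hf₀.2
      have hUV : U ⊆ V := hUf₀.trans (hE f₀ hf₀.1).1
      have hemp : disjointUnions (r + 1) (link (membersWithin E T) U) = ∅ := by
        by_contra h
        obtain ⟨B, hB⟩ := Finset.nonempty_of_ne_empty h
        have hBT : (B : Set α) ⊆ T := by
          refine subset_of_mem_disjointUnions (fun g hg => ?_) hB
          obtain ⟨f, hf, -, rfl⟩ := mem_link.1 hg
          exact (Finset.coe_subset.2 Finset.sdiff_subset).trans (mem_membersWithin.1 hf).2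
        have hBE : B ∈ disjointUnions (r + 1) (link E U) :=
          disjointUnions_mono (Finset.image_subset_image
            (Finset.filter_subset_filter _ (membersWithin_subset _ _))) hB
        refine hT (U ∪ B) (mem_stars.2 ⟨U, hUV, ⟨h1, hU⟩, B, hBE, rfl⟩) ?_
        rw [Finset.coe_union]
        exact Set.union_subset hUT hBT
      have hb : ∀ g ∈ link (membersWithin E T) U, g.card ≤ k := fun g hg => by
        obtain ⟨f, hf, -, rfl⟩ := mem_link.1 hg
        rw [← (hE f (mem_membersWithin.1 hf).1).2]
        exact Finset.card_le_card Finset.sdiff_subset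
      have h0 : ∀ g ∈ link (membersWithin E T) U, g.Nonempty := fun g hg => by
        obtain ⟨f, hf, -, rfl⟩ := mem_link.1 hg
        rw [Finset.sdiff_nonempty]
        intro hfU
        have := Finset.card_le_card hfU
        rw [(hE f (mem_membersWithin.1 hf).1).2] at this
        omega
      obtain ⟨Z, hZc, hZ⟩ := exists_hitting_set hb h0 hemp
      refine ⟨Z, by exact_mod_cast hZc, fun f hf hUf => ?_⟩
      have := hZ _ (mem_link.2 ⟨f, hf, hUf, rfl⟩)
      obtain ⟨v, hv1, hv2⟩ := Finset.not_disjoint_iff.1 this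
      rw [Finset.mem_sdiff] at hv1
      exact ⟨v, hv2, hv1.1, hv1.2⟩
    · exact ⟨∅, by simp; positivity, fun f hf hUf => (hne ⟨f, hf, hUf⟩).elim⟩

theorem sum_filter_meeting_le {F : Finset (Finset α)} {w : Finset α → ℝ} {L Δ : ℝ} (hL : 0 ≤ L)
    (hw : ∀ f ∈ F, w f ≤ L)
    (hΔ : ∀ v, ((F.filter fun f => {v} ⊆ f).card : ℝ) ≤ Δ) (W : Finset α) :
    ∑ g ∈ F.filter (fun g => ¬ Disjoint W g), w g ≤ L * (W.card * Δ) := by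
  have hsub : (F.filter fun g => ¬ Disjoint W g) ⊆ W.biUnion fun v => F.filter fun f => {v} ⊆ f := by
    intro g hg
    rw [Finset.mem_filter, Finset.not_disjoint_iff] at hg
    obtain ⟨hgF, v, hvW, hvg⟩ := hg
    exact Finset.mem_biUnion.2 ⟨v, hvW, Finset.mem_filter.2 ⟨hgF, by simpa using hvg⟩⟩
  calc _ ≤ ∑ g ∈ F.filter (fun g => ¬ Disjoint W g), L :=
        Finset.sum_le_sum fun g hg => hw g (Finset.mem_of_mem_filter _ hg)
    _ = L * (F.filter fun g => ¬ Disjoint W g).card := by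
        rw [Finset.sum_const, nsmul_eq_mul, mul_comm]
    _ ≤ L * ∑ v ∈ W, ((F.filter fun f => {v} ⊆ f).card : ℝ) := by
        refine mul_le_mul_of_nonneg_left ?_ hL
        exact_mod_cast (Finset.card_le_card hsub).trans Finset.card_biUnion_le
    _ ≤ L * (W.card * Δ) := by
        refine mul_le_mul_of_nonneg_left ?_ hL
        rw [← nsmul_eq_mul]
        exact Finset.sum_le_card_nsmul _ _ _ fun v _ => hΔ v

theorem card_le_of_mem_stars {V : Finset α} {E : Finset (Finset α)} {q k r : ℕ}
    (hE : ∀ f ∈ E, f.card = k) (hqk : q ≤ k) {A : Finset α} (hA : A ∈ stars V E q r) :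
    A.card ≤ (r + 1) * k := by
  obtain ⟨U, -, hU, B, hB, rfl⟩ := mem_stars.1 hA
  have h1 := Finset.card_union_le U B
  have h2 : B.card ≤ r * k := card_le_of_mem_disjointUnions (fun g hg => by
    obtain ⟨f, hf, -, rfl⟩ := mem_link.1 hg
    rw [← hE f hf]
    exact Finset.card_le_card Finset.sdiff_subset) hB
  rw [Nat.succ_mul]
  omega

/-- If `S` contains no `s + 1` disjoint stars with `r + 1` petals and no star with `R + 1` petals,
then deleting few members inside `S` leaves a family with bounded degrees. -/
theorem exists_sparse_subfamily {V : Finset α} {E : Finset (Finset α)} {q k r s R : ℕ} {D L : ℝ}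
    (hE : ∀ f ∈ E, f ⊆ V ∧ f.card = k) (hq : 1 ≤ q) (hqk : q ≤ k)
    (hD : ∀ U : Finset α, U.card = q → ((E.filter fun f => U ⊆ f).card : ℝ) ≤ D) (hD0 : 0 ≤ D)
    {w : Finset α → ℝ} (hL : 0 ≤ L) (hw : ∀ f ∈ E, w f ≤ L) {S : Set α}
    (hs : ∀ A ∈ disjointUnions (s + 1) (stars V E q (r + 1)), ¬ (A : Set α) ⊆ S)
    (hR : ∀ A ∈ stars V E q (R + 1), ¬ (A : Set α) ⊆ S) :
    ∃ J ⊆ membersWithin E S,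
      (∀ f ∈ J, ∑ g ∈ J.filter (fun g => ¬ Disjoint f g), w g ≤
        L * (k * (D * ((r * k : ℕ) : ℝ) ^ (q - 1)))) ∧
      ∑ f ∈ membersWithin E S, w f ≤ ∑ f ∈ J, w f +
        L * (((s * ((r + 2) * k) : ℕ) : ℝ) * (D * ((R * k : ℕ) : ℝ) ^ (q - 1))) := by
  have hemp : disjointUnions (s + 1) (membersWithin (stars V E q (r + 1)) S) = ∅ := by
    by_contra h
    obtain ⟨B, hB⟩ := Finset.nonempty_of_ne_empty h
    exact hs B (disjointUnions_mono (membersWithin_subset _ _) hB)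
      (subset_of_mem_disjointUnions (fun g hg => (mem_membersWithin.1 hg).2) hB)
  obtain ⟨W, hWc, hW⟩ := exists_hitting_set (b := (r + 2) * k)
    (fun A hA => card_le_of_mem_stars (fun f hf => (hE f hf).2) hqk (mem_membersWithin.1 hA).1)
    (fun A hA => by
      obtain ⟨U, -, hU, B, -, rfl⟩ := mem_stars.1 (mem_membersWithin.1 hA).1
      exact (Finset.card_pos.1 hU.1).mono Finset.subset_union_left) hemp
  -- Every star with `r + 1` petals inside `S` meets `W`, so none survives in `S \ W`.
  have hdeg : ∀ v, (((membersWithin E (S \ W)).filter fun f => {v} ⊆ f).card : ℝ) ≤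
      D * ((r * k : ℕ) : ℝ) ^ (q - 1) := by
    intro v
    refine card_filter_superset_le_of_stars hE hqk hD hD0 (fun A hA hAT => ?_) {v} (by simp)
      (by simpa using hq)
    refine hW A (mem_membersWithin.2 ⟨hA, hAT.trans Set.sdiff_subset⟩) ?_
    rw [← Finset.disjoint_coe]
    exact Set.disjoint_sdiff_left.mono_left hAT
  -- The deleted members are counted with degrees in all of `S`, where only the larger stars are
  -- excluded.
  have hdegS : ∀ v, (((membersWithin E S).filter fun f => {v} ⊆ f).card : ℝ) ≤
      D * ((R * k : ℕ) : ℝ) ^ (q - 1) := fun v =>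
    card_filter_superset_le_of_stars hE hqk hD hD0 hR {v} (by simp) (by simpa using hq)
  refine ⟨membersWithin E (S \ W), membersWithin_mono Set.sdiff_subset, fun f hf => ?_, ?_⟩
  · have := sum_filter_meeting_le hL (fun f hf => hw f (membersWithin_subset _ _ hf)) hdeg f
    rwa [(hE f (membersWithin_subset _ _ hf)).2] at this
  · have h1 := sum_filter_meeting_le hL (fun f hf => hw f (membersWithin_subset E S hf)) hdegS W
    have h2 := Finset.sum_filter_add_sum_filter_not (membersWithin E S) (fun g => Disjoint W g) w
    have h3 : (membersWithin E S).filter (fun g => Disjoint W g) = membersWithin E (S \ W) := by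
      ext g
      simp only [Finset.mem_filter, mem_membersWithin, Set.subset_sdiff, and_assoc,
        Finset.disjoint_coe, disjoint_comm]
    have h4 : L * (W.card * (D * ((R * k : ℕ) : ℝ) ^ (q - 1))) ≤
        L * (((s * ((r + 2) * k) : ℕ) : ℝ) * (D * ((R * k : ℕ) : ℝ) ^ (q - 1))) := by
      gcongr
    rw [h3] at h2
    linarith

end Stars

/-! ### Elementary bounds on the rate. -/

section TailRate

theorem tailRate_le (q : ℕ) (N μ t : ℝ) :
    tailRate q N μ t ≤ t ^ (1 / (q : ℝ)) * Real.log N := by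
  rw [tailRate]
  split_ifs
  · exact le_rfl
  · exact min_le_right _ _

theorem phi_nonneg {x : ℝ} (hx : 0 ≤ x) : 0 ≤ phi x := by
  have h := Real.one_sub_inv_le_log_of_pos (show 0 < 1 + x by linarith)
  have h2 := mul_le_mul_of_nonneg_left h (show 0 ≤ 1 + x by linarith)
  rw [mul_sub, mul_inv_cancel₀ (by linarith)] at h2
  rw [phi]
  linarith

/-- From `log (1 + x) ≤ x` one gets `φ(x) ≤ x log (1 + x)`; Bernoulli's inequality `1 + x ≤ (1 + x /
4) ^ 4` then moves to the argument `x / 4`, as the moment bound is used at `t / 4`. -/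
theorem phi_le_mul_log {x : ℝ} (hx : 0 ≤ x) : phi x ≤ 4 * x * Real.log (1 + x / 4) := by
  have h1 := Real.log_le_sub_one_of_pos (show 0 < 1 + x by linarith)
  have h2 : 1 + x ≤ (1 + x / 4) ^ 4 := by
    have := one_add_mul_le_pow (show -2 ≤ x / 4 by linarith) 4
    push_cast at this
    linarith
  have h3 : Real.log (1 + x) ≤ 4 * Real.log (1 + x / 4) := by
    have := Real.log_le_log (by linarith) h2
    rwa [Real.log_pow] at this
  have h4 := mul_le_mul_of_nonneg_left h3 hx
  rw [phi]
  linarith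

theorem phi_mul_le {μ t : ℝ} (hμ : 0 < μ) (ht : 0 < t) :
    phi (t / μ) * μ ≤ 16 * (t / 4 * Real.log (1 + t / 4 / μ)) := by
  have h := mul_le_mul_of_nonneg_right (phi_le_mul_log (div_pos ht hμ).le) hμ.le
  refine h.trans (le_of_eq ?_)
  rw [show t / 4 / μ = t / μ / 4 by ring]
  field_simp
  ring

end TailRate

/-! ### The exponent computation behind the condition on `p`. -/

section Exponents

/-- As `q ≤ k`, the ratio `(q - j) / (k - j)` is largest at `j = 1`, where it equals `θ`. Hence the
powers of `N` leave at most `N ^ (-σ)`, half of which absorbs the constants. -/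
theorem mul_pow_mul_pow_le {k q j : ℕ} {D σ Λ N p : ℝ} (hj : 1 ≤ j) (hjq : j < q) (hqk : q ≤ k)
    (hD : 0 < D) (hσ : 0 < σ) (hΛ : 0 < Λ) (hN : 1 ≤ N) (hp : 0 ≤ p)
    (hpN : p ≤ Λ * N ^ (-(((q : ℝ) - 1) / ((k : ℝ) - 1)) - σ))
    (hB : D * max 1 Λ ^ k ≤ N ^ (σ / 2)) :
    D * N ^ (q - j) * p ^ (k - j) ≤ N ^ (-(σ / 2)) := by
  have hN0 : 0 < N := by linarith
  set θ : ℝ := ((q : ℝ) - 1) / ((k : ℝ) - 1) with hθ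
  have hj' : (1 : ℝ) ≤ j := by exact_mod_cast hj
  have hjq' : (j : ℝ) + 1 ≤ q := by exact_mod_cast hjq
  have hqk' : (q : ℝ) ≤ k := by exact_mod_cast hqk
  have hθ1 : ((q : ℝ) - j) ≤ θ * (k - j) := by
    rw [hθ, div_mul_eq_mul_div, le_div_iff₀ (by linarith)]
    nlinarith
  have h1 : p ^ (k - j) ≤ Λ ^ (k - j) * N ^ ((-θ - σ) * ((k : ℝ) - j)) := by
    refine (pow_le_pow_left₀ hp hpN _).trans (le_of_eq ?_)
    rw [mul_pow, ← Real.rpow_mul_natCast hN0.le, Nat.cast_sub (by omega)]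
  have h2 : Λ ^ (k - j) ≤ max 1 Λ ^ k :=
    (pow_le_pow_left₀ hΛ.le (le_max_right _ _) _).trans
      (pow_le_pow_right₀ (le_max_left _ _) (Nat.sub_le _ _))
  calc D * N ^ (q - j) * p ^ (k - j)
      ≤ D * N ^ (q - j) * (max 1 Λ ^ k * N ^ ((-θ - σ) * ((k : ℝ) - j))) := by
        refine mul_le_mul_of_nonneg_left (h1.trans ?_) (by positivity)
        exact mul_le_mul_of_nonneg_right h2 (by positivity)
    _ = D * max 1 Λ ^ k * (N ^ ((q : ℝ) - j) * N ^ ((-θ - σ) * ((k : ℝ) - j))) := by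
        rw [← Nat.cast_sub hjq.le, Real.rpow_natCast]
        ring
    _ ≤ N ^ (σ / 2) * (N ^ ((q : ℝ) - j) * N ^ ((-θ - σ) * ((k : ℝ) - j))) :=
        mul_le_mul_of_nonneg_right hB (by positivity)
    _ = N ^ (σ / 2 + (((q : ℝ) - j) + (-θ - σ) * ((k : ℝ) - j))) := by
        rw [Real.rpow_add hN0, Real.rpow_add hN0]
    _ ≤ N ^ (-(σ / 2)) := by
        refine Real.rpow_le_rpow_of_exponent_le hN ?_
        nlinarith

end Exponents

/-! ### The tail bound for large `N` and for bounded `N`. -/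

section LargeVertexBound

variable {α : Type*} [DecidableEq α]

/-- The first `r + 1` petals pay for the at most `k * N ^ k ≤ N ^ (k + 1)` cores and leave a factor
`N⁻¹`; the other `s` petals each gain `N ^ (-(σ / 2))`. -/
theorem sum_pow_card_stars_le_rpow {V : Finset α} {E : Finset (Finset α)} {q k r : ℕ}
    {D N p σ Λ : ℝ} (hE : ∀ f ∈ E, f ⊆ V ∧ f.card = k) (hqk : q ≤ k)
    (hV : (V.card : ℝ) ≤ N)
    (hD : ∀ U : Finset α, U.card = q → ((E.filter fun f => U ⊆ f).card : ℝ) ≤ D) (hD0 : 0 < D)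
    (hσ : 0 < σ) (hΛ : 0 < Λ) (hN : 1 ≤ N) (hkN : (k : ℝ) ≤ N) (hp : 0 ≤ p) (hp1 : p ≤ 1)
    (hpN : p ≤ Λ * N ^ (-(((q : ℝ) - 1) / ((k : ℝ) - 1)) - σ))
    (hB : D * max 1 Λ ^ k ≤ N ^ (σ / 2)) (hr : k + 2 ≤ σ / 2 * (r + 1)) (s : ℕ) :
    ∑ A ∈ stars V E q (r + s + 1), p ^ A.card ≤ N ^ (-(1 + σ / 2 * s)) := by
  have hN0 : 0 < N := by linarith
  have h := sum_pow_card_stars_le (r := r + s + 1) (a := N ^ (-(σ / 2))) hp hp1 hN hV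
    (fun f hf => (hE f hf).2) hqk (by positivity) (fun U hU1 hU2 => by
      refine le_trans (mul_le_mul_of_nonneg_right
        (card_filter_superset_le_pow hE hqk hV hD hD0.le U hU2.le) (pow_nonneg hp _)) ?_
      exact mul_pow_mul_pow_le hU1 hU2 hqk hD0 hσ hΛ hN hp hpN hB)
  refine h.trans ?_
  calc (k : ℝ) * N ^ k * (N ^ (-(σ / 2))) ^ (r + s + 1)
      ≤ N * N ^ k * (N ^ (-(σ / 2))) ^ (r + s + 1) := by gcongr
    _ = N ^ ((1 : ℝ) + k + -(σ / 2) * ((r + s + 1 : ℕ) : ℝ)) := by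
        rw [Real.rpow_add hN0, Real.rpow_add hN0, Real.rpow_one, Real.rpow_natCast,
          Real.rpow_mul_natCast hN0.le]
    _ ≤ _ := by
        refine Real.rpow_le_rpow_of_exponent_le hN ?_
        push_cast
        linarith

/-- The weight of the members destroyed by the deletion is at most `t / 2`. -/
theorem deleted_weight_le {L D t c₀ : ℝ} {q k r : ℕ} (hL : 0 < L) (hD : 0 < D) (ht : 0 < t)
    (hq : 1 ≤ q) (hqk : q ≤ k) (hc₀ : 0 < c₀) (hc₀1 : c₀ ≤ 1)
    (hc₀K : L * ((r + 2) * k) * D * ((r + 1) * k) ^ k * c₀ ≤ 1 / 2) {s : ℕ}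
    (hs : (s : ℝ) ≤ c₀ * t ^ (1 / (q : ℝ))) :
    L * (((s * ((r + 2) * k) : ℕ) : ℝ) * (D * (((r + s) * k : ℕ) : ℝ) ^ (q - 1))) ≤ t / 2 := by
  -- Nothing is deleted when `s = 0`; this case is separate because `r + s ≤ (r + 1) * s` needs `s ≥
  -- 1`.
  rcases s.eq_zero_or_pos with rfl | hs0
  · simp; linarith
  have hs1 : (1 : ℝ) ≤ s := by exact_mod_cast hs0
  have hk1 : (1 : ℝ) ≤ k := by exact_mod_cast hq.trans hqk
  have hr0 : (0 : ℝ) ≤ r := Nat.cast_nonneg r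
  have hb1 : 1 ≤ ((r : ℝ) + 1) * k := by nlinarith
  have h1 : (((r + s) * k : ℕ) : ℝ) ^ (q - 1) ≤ (((r : ℝ) + 1) * k) ^ k * (s : ℝ) ^ (q - 1) := by
    calc (((r + s) * k : ℕ) : ℝ) ^ (q - 1) ≤ (((r : ℝ) + 1) * k * s) ^ (q - 1) := by
          refine pow_le_pow_left₀ (Nat.cast_nonneg _) ?_ _
          push_cast
          nlinarith [mul_nonneg hr0 (sub_nonneg.2 hs1)]
      _ = (((r : ℝ) + 1) * k) ^ (q - 1) * (s : ℝ) ^ (q - 1) := mul_pow _ _ _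
      _ ≤ _ := by
          refine mul_le_mul_of_nonneg_right (pow_le_pow_right₀ hb1 (by omega)) (by positivity)
  have h2 : (s : ℝ) ^ q ≤ c₀ * t := by
    calc (s : ℝ) ^ q ≤ (c₀ * t ^ (1 / (q : ℝ))) ^ q := pow_le_pow_left₀ (by positivity) hs _
      _ = c₀ ^ q * t := by
          rw [mul_pow, one_div, Real.rpow_inv_natCast_pow ht.le (by omega)]
      _ ≤ c₀ * t := by
          refine mul_le_mul_of_nonneg_right ?_ ht.le
          exact pow_le_of_le_one hc₀.le hc₀1 (by omega)
  calc _ ≤ L * (((s * ((r + 2) * k) : ℕ) : ℝ) *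
        (D * ((((r : ℝ) + 1) * k) ^ k * (s : ℝ) ^ (q - 1)))) := by gcongr
    _ = L * ((r + 2) * k) * D * ((r + 1) * k) ^ k * (s : ℝ) ^ q := by
        rw [← Nat.sub_add_cancel hq, pow_succ, Nat.add_sub_cancel]
        push_cast
        ring
    _ ≤ L * ((r + 2) * k) * D * ((r + 1) * k) ^ k * (c₀ * t) :=
        mul_le_mul_of_nonneg_left h2 (by positivity)
    _ = (L * ((r + 2) * k) * D * ((r + 1) * k) ^ k * c₀) * t := by ring
    _ ≤ 1 / 2 * t := mul_le_mul_of_nonneg_right hc₀K ht.le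
    _ = t / 2 := by ring

variable {P : Measure (Set α)} [IsProbabilityMeasure P] {p : ℝ}

/-- The upper tail bound when `N` is large. -/
theorem IsSpread.upper_tail_of_large [Finite α] (h : IsSpread P p) {V : Finset α} {E : Finset (Finset α)}
    {q k r : ℕ} {D L N σ Λ c c₀ t : ℝ} {w : Finset α → ℝ}
    (hE : ∀ f ∈ E, f ⊆ V ∧ f.card = k) (hq : 1 ≤ q) (hqk : q ≤ k)
    (hV : (V.card : ℝ) ≤ N)
    (hD : ∀ U : Finset α, U.card = q → ((E.filter fun f => U ⊆ f).card : ℝ) ≤ D) (hD0 : 0 < D)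
    (hL : 0 < L) (hw0 : ∀ f, 0 ≤ w f) (hw : ∀ f ∈ E, w f ≤ L)
    (hσ : 0 < σ) (hΛ : 0 < Λ) (hN : 1 ≤ N) (hkN : (k : ℝ) ≤ N)
    (hpN : p ≤ Λ * N ^ (-(((q : ℝ) - 1) / ((k : ℝ) - 1)) - σ))
    (hB : D * max 1 Λ ^ k ≤ N ^ (σ / 2)) (hr1 : 1 ≤ r) (hr : k + 2 ≤ σ / 2 * (r + 1))
    (hc₀ : 0 < c₀) (hc₀1 : c₀ ≤ 1)
    (hc₀K : L * ((r + 2) * k) * D * ((r + 1) * k) ^ k * c₀ ≤ 1 / 2)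
    (hc0 : 0 ≤ c) (hc1 : c ≤ min 1 (σ / 2) * c₀)
    (hc2 : c ≤ 1 / (16 * (L * (k * (D * ((r * k : ℕ) : ℝ) ^ k))))) (ht : 0 < t) :
    P.real {S | meanWeight P E w + t ≤ ∑ f ∈ membersWithin E S, w f} ≤
      3 * Real.exp (-(c * tailRate q N (meanWeight P E w) t)) := by
  have hN0 : 0 < N := by linarith
  have hlog : 0 ≤ Real.log N := Real.log_nonneg hN
  have hk : 1 ≤ k := hq.trans hqk
  set μ := meanWeight P E w with hμdef
  have hμ0 : 0 ≤ μ := meanWeight_nonneg P E hw0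
  set x := t ^ (1 / (q : ℝ)) with hx
  have hx0 : 0 ≤ x := Real.rpow_nonneg ht.le _
  -- At mean zero, Markov's inequality gives probability zero, whatever the rate.
  rcases hμ0.eq_or_lt with hμ | hμ
  · have hmk := mul_meas_ge_le_integral_of_nonneg (μ := P)
      (f := fun S => ∑ f ∈ membersWithin E S, w f)
      (Filter.Eventually.of_forall fun S => Finset.sum_nonneg fun f _ => hw0 f)
      Integrable.of_finite t
    rw [integral_sum_membersWithin, ← hμdef, ← hμ] at hmk
    have hz : P.real {S | t ≤ ∑ f ∈ membersWithin E S, w f} ≤ 0 := by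
      by_contra hcon
      exact absurd hmk (not_le.2 (mul_pos ht (not_le.1 hcon)))
    rw [← hμ, zero_add]
    exact hz.trans (by positivity)
  set s := ⌊c₀ * x⌋₊ with hs
  have hs1 : (s : ℝ) ≤ c₀ * x := Nat.floor_le (by positivity)
  have hs2 : c₀ * x ≤ s + 1 := (Nat.lt_floor_add_one _).le
  set η := min 1 (σ / 2) with hη
  have hη0 : 0 < η := lt_min one_pos (by linarith)
  have hstars := sum_pow_card_stars_le_rpow hE hqk hV hD hD0 hσ hΛ hN hkN h.nonneg h.le_one hpN
    hB hr
  -- Rounding down gives `c₀ * x ≤ s + 1`, so an exponent of `η * (s + 1)` suffices. The extra `1`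
  -- covers `s = 0`.
  have hexp : ∀ y : ℝ, η * (s + 1) ≤ y →
      N ^ (-y) ≤ Real.exp (-(c * tailRate q N μ t)) := by
    intro y hy
    rw [Real.rpow_def_of_pos hN0, Real.exp_le_exp]
    have h1 := mul_le_mul_of_nonneg_left (tailRate_le q N μ t) hc0
    have h2 : c * x ≤ y := (mul_le_mul_of_nonneg_right hc1 hx0).trans
      (by rw [mul_assoc]; exact (mul_le_mul_of_nonneg_left hs2 hη0.le).trans hy)
    have h3 := mul_le_mul_of_nonneg_right h2 hlog
    rw [← hx] at h1
    nlinarith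
  have hP1 : P.real {S | ∃ A ∈ disjointUnions (s + 1) (stars V E q (r + 1)), (A : Set α) ⊆ S} ≤
      Real.exp (-(c * tailRate q N μ t)) := by
    refine le_trans ?_ (hexp (s + 1) (mul_le_of_le_one_left (by positivity) (min_le_left _ _)))
    refine (h.prob_exists_subset_le _).trans
      ((sum_pow_card_disjointUnions_le h.nonneg _ _).trans ?_)
    have h0 := hstars 0
    simp only [add_zero, Nat.cast_zero, mul_zero] at h0
    refine (pow_le_pow_left₀ (Finset.sum_nonneg fun _ _ => pow_nonneg h.nonneg _) h0 _).trans
      (le_of_eq ?_)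
    rw [← Real.rpow_mul_natCast hN0.le]
    push_cast
    congr 1
    ring
  have hP2 : P.real {S | ∃ A ∈ stars V E q (r + s + 1), (A : Set α) ⊆ S} ≤
      Real.exp (-(c * tailRate q N μ t)) := by
    refine le_trans ((h.prob_exists_subset_le _).trans (hstars s)) (hexp _ ?_)
    have h1 : η ≤ 1 := min_le_left _ _
    have h2 : η * s ≤ σ / 2 * s := mul_le_mul_of_nonneg_right (min_le_right _ _) (Nat.cast_nonneg _)
    linarith
  -- The exponent `k` replaces `q - 1` so that `c` can be chosen independently of `q`.
  set κ := L * (k * (D * ((r * k : ℕ) : ℝ) ^ k)) with hκ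
  have hrk : (1 : ℝ) ≤ ((r * k : ℕ) : ℝ) := by exact_mod_cast Nat.mul_pos hr1 hk
  have hκ0 : 0 < κ := by
    have : (0 : ℝ) < k := by exact_mod_cast hk
    positivity
  -- Deletion leaves at least `μ + t / 2 = μ + 2 * (t / 4)`.
  have hP3 := h.prob_sparse_subfamily_le E hw0 hκ0 (show 0 < t / 4 by linarith) hμ
  have hP3' : Real.exp (-(t / 4 / κ * Real.log (1 + t / 4 / μ))) ≤
      Real.exp (-(c * tailRate q N μ t)) := by
    rw [Real.exp_le_exp, neg_le_neg_iff]
    have h1 : tailRate q N μ t ≤ phi (t / μ) * μ := by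
      rw [tailRate, if_neg hμ.ne']
      exact min_le_left _ _
    have h2 : 0 ≤ phi (t / μ) * μ := mul_nonneg (phi_nonneg (div_pos ht hμ).le) hμ.le
    calc c * tailRate q N μ t ≤ c * (phi (t / μ) * μ) := mul_le_mul_of_nonneg_left h1 hc0
      _ ≤ 1 / (16 * κ) * (phi (t / μ) * μ) := mul_le_mul_of_nonneg_right hc2 h2
      _ ≤ 1 / (16 * κ) * (16 * (t / 4 * Real.log (1 + t / 4 / μ))) :=
          mul_le_mul_of_nonneg_left (phi_mul_le hμ ht) (by positivity)
      _ = _ := by field_simp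
  have hsub : {S | μ + t ≤ ∑ f ∈ membersWithin E S, w f} ⊆
      ({S | ∃ A ∈ disjointUnions (s + 1) (stars V E q (r + 1)), (A : Set α) ⊆ S} ∪
        {S | ∃ A ∈ stars V E q (r + s + 1), (A : Set α) ⊆ S}) ∪
      {S | ∃ J ⊆ membersWithin E S,
        (∀ f ∈ J, ∑ g ∈ J.filter (fun g => ¬ Disjoint f g), w g ≤ κ) ∧
        μ + 2 * (t / 4) ≤ ∑ f ∈ J, w f} := by
    intro S hS
    by_cases h1 : ∃ A ∈ disjointUnions (s + 1) (stars V E q (r + 1)), (A : Set α) ⊆ S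
    · exact Or.inl (Or.inl h1)
    by_cases h2 : ∃ A ∈ stars V E q (r + s + 1), (A : Set α) ⊆ S
    · exact Or.inl (Or.inr h2)
    right
    push Not at h1 h2
    obtain ⟨J, hJ, hJκ, hJw⟩ := exists_sparse_subfamily hE hq hqk hD hD0.le hL.le hw h1 h2
    refine ⟨J, hJ, fun f hf => (hJκ f hf).trans ?_, ?_⟩
    · rw [hκ]
      gcongr
      omega
    · have h3 := deleted_weight_le hL hD0 ht hq hqk hc₀ hc₀1 hc₀K hs1
      have h4 : μ + t ≤ ∑ f ∈ membersWithin E S, w f := hS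
      linarith
  calc _ ≤ _ := measureReal_mono (μ := P) hsub
    _ ≤ _ := measureReal_union_le _ _
    _ ≤ _ := add_le_add_left (measureReal_union_le _ _) _
    _ ≤ 3 * Real.exp (-(c * tailRate q N μ t)) := by linarith

/-- The upper tail bound when `N` is bounded. -/
theorem upper_tail_of_bounded {V : Finset α} {E : Finset (Finset α)}
    {q k : ℕ} {D L N N₀ c t : ℝ} {w : Finset α → ℝ}
    (hE : ∀ f ∈ E, f ⊆ V ∧ f.card = k) (hq : 1 ≤ q) (hqk : q ≤ k) (hV : (V.card : ℝ) ≤ N)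
    (hD : ∀ U : Finset α, U.card = q → ((E.filter fun f => U ⊆ f).card : ℝ) ≤ D) (hD0 : 0 < D)
    (hL : 0 < L) (hw0 : ∀ f, 0 ≤ w f) (hw : ∀ f ∈ E, w f ≤ L) (hN : 1 ≤ N) (hN₀ : N ≤ N₀)
    (hc0 : 0 ≤ c) (hc : c * ((1 + L * (D * N₀ ^ k)) * N₀) ≤ 1) (ht : 0 < t) :
    P.real {S | meanWeight P E w + t ≤ ∑ f ∈ membersWithin E S, w f} ≤
      3 * Real.exp (-(c * tailRate q N (meanWeight P E w) t)) := by
  set μ := meanWeight P E w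
  have hμ0 : 0 ≤ μ := meanWeight_nonneg P E hw0
  -- A set in the event bounds `t` by the total weight of `E`, hence bounds the rate.
  rcases Set.eq_empty_or_nonempty {S | μ + t ≤ ∑ f ∈ membersWithin E S, w f} with he | ⟨S, hS⟩
  · rw [he, measureReal_empty]
    positivity
  have hS' : μ + t ≤ ∑ f ∈ membersWithin E S, w f := hS
  have hEc : (E.card : ℝ) ≤ D * N₀ ^ k := by
    have h1 := card_filter_superset_le_pow hE hqk hV hD hD0.le ∅ (by simp)
    simp only [Finset.empty_subset, Finset.filter_true, Finset.card_empty, Nat.sub_zero] at h1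
    refine h1.trans (mul_le_mul_of_nonneg_left ?_ hD0.le)
    exact (pow_le_pow_left₀ (by linarith) hN₀ _).trans (pow_le_pow_right₀ (by linarith) hqk)
  have htT : t ≤ L * (D * N₀ ^ k) := by
    calc t ≤ ∑ f ∈ membersWithin E S, w f := by linarith
      _ ≤ ∑ f ∈ E, w f :=
          Finset.sum_le_sum_of_subset_of_nonneg (membersWithin_subset _ _) fun f _ _ => hw0 f
      _ ≤ ∑ f ∈ E, L := Finset.sum_le_sum hw
      _ = L * E.card := by rw [Finset.sum_const, nsmul_eq_mul, mul_comm]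
      _ ≤ _ := mul_le_mul_of_nonneg_left hEc hL.le
  have hx : t ^ (1 / (q : ℝ)) ≤ 1 + L * (D * N₀ ^ k) := by
    have hq1 : 1 / (q : ℝ) ≤ 1 := by
      rw [div_le_one (by exact_mod_cast hq)]
      exact_mod_cast hq
    calc t ^ (1 / (q : ℝ)) ≤ (1 + t) ^ (1 / (q : ℝ)) :=
          Real.rpow_le_rpow ht.le (by linarith) (by positivity)
      _ ≤ (1 + t) ^ (1 : ℝ) := Real.rpow_le_rpow_of_exponent_le (by linarith) hq1
      _ ≤ _ := by rw [Real.rpow_one]; linarith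
  have hlogN : Real.log N ≤ N₀ := by
    have := Real.log_le_sub_one_of_pos (show 0 < N by linarith)
    linarith
  have hrate : c * tailRate q N μ t ≤ 1 := by
    refine le_trans (mul_le_mul_of_nonneg_left ((tailRate_le q N μ t).trans ?_) hc0) hc
    exact mul_le_mul hx hlogN (Real.log_nonneg hN) (by linarith)
  calc P.real _ ≤ 1 := measureReal_le_one
    -- The factor `3`, which for large `N` counts the three events, here makes the bound trivial
    -- since `e < 3`.
    _ ≤ 3 * Real.exp (-1) := by
        rw [Real.exp_neg, ← div_eq_mul_inv, one_le_div (Real.exp_pos _)]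
        exact Real.exp_one_lt_three.le
    _ ≤ _ := by gcongr

end LargeVertexBound

-- Choice of the constants, uniformly in `q`, `N` and the law.

universe u

theorem exists_upper_tail_constant (k : ℕ) (D L σ Λ : ℝ) (hk : 2 ≤ k) (hD0 : 0 < D) (hL : 0 < L)
    (hσ : 0 < σ) (hΛ : 0 < Λ) :
    ∃ c : ℝ, 0 < c ∧ ∀ (q : ℕ) (N : ℝ), 1 ≤ q → q ≤ k → 1 ≤ N →
      ∀ (α : Type u) [DecidableEq α] [Finite α] (P : Measure (Set α)) [IsProbabilityMeasure P]
        (p : ℝ) (V : Finset α) (E : Finset (Finset α)) (w : Finset α → ℝ),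
        IsSpread P p → (∀ f ∈ E, f ⊆ V ∧ f.card = k) → (V.card : ℝ) ≤ N →
        (∀ U : Finset α, U.card = q → ((E.filter fun f => U ⊆ f).card : ℝ) ≤ D) →
        (∀ f, 0 ≤ w f) → (∀ f ∈ E, w f ≤ L) →
        p ≤ Λ * N ^ (-(((q : ℝ) - 1) / ((k : ℝ) - 1)) - σ) → ∀ t : ℝ, 0 < t →
        P.real {S | meanWeight P E w + t ≤ ∑ f ∈ membersWithin E S, w f} ≤
          3 * Real.exp (-(c * tailRate q N (meanWeight P E w) t)) := by
  have hk0 : (0 : ℝ) < k := by exact_mod_cast (by omega : 0 < k)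
  obtain ⟨N₀, hN₀⟩ := Filter.eventually_atTop.1
    ((tendsto_rpow_atTop (show 0 < σ / 2 by linarith)).eventually_ge_atTop (D * max 1 Λ ^ k))
  obtain ⟨r, hr⟩ := exists_nat_ge ((k + 2) / (σ / 2))
  have hr1 : 1 ≤ r := by
    have : (0 : ℝ) < r := lt_of_lt_of_le (by positivity) hr
    exact_mod_cast this
  have hr2 : (k : ℝ) + 2 ≤ σ / 2 * (r + 1) := by
    rw [div_le_iff₀ (by linarith)] at hr
    linarith
  -- Beyond `N₁` both `D * max 1 Λ ^ k ≤ N ^ (σ / 2)` and `k ≤ N` hold; below it the bounded case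
  -- applies.
  set N₁ := max N₀ k
  have hN₁ : 0 < N₁ := lt_of_lt_of_le hk0 (le_max_right _ _)
  set K := L * ((r + 2) * k) * D * ((r + 1) * k) ^ k with hK
  have hK0 : 0 < K := by positivity
  set c₀ := min 1 (1 / (2 * K)) with hc₀
  have hc₀0 : 0 < c₀ := lt_min one_pos (by positivity)
  have hc₀K : K * c₀ ≤ 1 / 2 := by
    calc K * c₀ ≤ K * (1 / (2 * K)) := mul_le_mul_of_nonneg_left (min_le_right _ _) hK0.le
      _ = 1 / 2 := by field_simp
  have hκ : 0 < 16 * (L * (k * (D * ((r * k : ℕ) : ℝ) ^ k))) := by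
    have : (0 : ℝ) < ((r * k : ℕ) : ℝ) := by exact_mod_cast Nat.mul_pos hr1 (by omega)
    positivity
  have hT : 0 < (1 + L * (D * N₁ ^ k)) * N₁ := by positivity
  refine ⟨min (min (min 1 (σ / 2) * c₀) (1 / (16 * (L * (k * (D * ((r * k : ℕ) : ℝ) ^ k))))))
    (1 / ((1 + L * (D * N₁ ^ k)) * N₁)),
    lt_min (lt_min (mul_pos (lt_min one_pos (by linarith)) hc₀0) (by positivity)) (by positivity),
    ?_⟩
  set c := min (min (min 1 (σ / 2) * c₀) (1 / (16 * (L * (k * (D * ((r * k : ℕ) : ℝ) ^ k))))))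
    (1 / ((1 + L * (D * N₁ ^ k)) * N₁)) with hc
  have hc0 : 0 ≤ c := (lt_min (lt_min (mul_pos (lt_min one_pos (by linarith)) hc₀0)
    (by positivity)) (by positivity)).le
  intro q N hq hqk hN α _ _ P _ p V E w h hE hV hD hw0 hw hpN t ht
  rcases le_total N N₁ with hNN | hNN
  · refine upper_tail_of_bounded hE hq hqk hV hD hD0 hL hw0 hw hN hNN hc0 ?_ ht
    rw [← le_div_iff₀ hT]
    exact min_le_right _ _
  · exact h.upper_tail_of_large hE hq hqk hV hD hD0 hL hw0 hw hσ hΛ hN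
      ((le_max_right _ _).trans hNN) hpN (hN₀ N ((le_max_left _ _).trans hNN)) hr1 hr2 hc₀0
      (min_le_left _ _) hc₀K hc0 ((min_le_left _ _).trans (min_le_left _ _))
      ((min_le_left _ _).trans (min_le_right _ _)) ht

/-! ### The binomial and the uniform random set are spread. -/

section Laws

variable {α : Type*}

theorem setBernoulli_real_superset [Finite α] (u : Set α) (p : unitInterval) (A : Finset α)
    [DecidablePred (· ∈ u)] :
    (setBernoulli u p).real {S | (A : Set α) ⊆ S} = ∏ i ∈ A, if i ∈ u then (p : ℝ) else 0 := by
  have h1 : (fun q : α → Prop => {i | q i}) ⁻¹' {S : Set α | (A : Set α) ⊆ S} =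
      Set.pi (A : Set α) fun _ => {True} := by
    ext q
    simp [Set.subset_def, Set.mem_pi]
  rw [measureReal_def, setBernoulli_apply', h1, Measure.infinitePi_pi _ (fun _ _ => .of_discrete),
    ENNReal.toReal_prod]
  refine Finset.prod_congr rfl fun i _ => ?_
  by_cases hi : i ∈ u <;> simp [hi]

theorem isSpread_setBernoulli [Finite α] (u : Set α) (p : unitInterval) :
    IsSpread (setBernoulli u p) p := by
  classical
  refine ⟨p.2.1, p.2.2, fun v => ?_, fun A B hAB => le_of_eq ?_⟩
  · have h := setBernoulli_real_superset u p {v}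
    simp only [Finset.coe_singleton, Set.singleton_subset_iff, Finset.prod_singleton] at h
    rw [h]
    split_ifs
    · exact le_rfl
    · exact p.2.1
  · rw [setBernoulli_real_superset, setBernoulli_real_superset, ← Finset.prod_union hAB,
      ← setBernoulli_real_superset]
    congr 1
    ext S
    simp [Set.union_subset_iff]

theorem uniformOn_real_superset [Finite α] [DecidableEq α] (V : Finset α) (m : ℕ) (A : Finset α) :
    (uniformOn {S : Set α | S ⊆ V ∧ S.ncard = m}).real {S | (A : Set α) ⊆ S} =
      (((V.powersetCard m).filter fun B => A ⊆ B).card : ℝ) / V.card.choose m := by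
  classical
  have h1 : {S : Set α | S ⊆ V ∧ S.ncard = m} =
      (((V.powersetCard m).image fun B : Finset α => (B : Set α) : Finset (Set α)) :
        Set (Set α)) := by
    ext S
    simp only [Set.mem_ofPred_eq, Finset.coe_image, Set.mem_image, Finset.mem_coe,
      Finset.mem_powersetCard]
    constructor
    · rintro ⟨h1, h2⟩
      lift S to Finset α using Set.toFinite S
      exact ⟨S, ⟨by exact_mod_cast h1, by simpa using h2⟩, rfl⟩
    · rintro ⟨B, ⟨h1, h2⟩, rfl⟩
      exact ⟨by exact_mod_cast h1, by simpa using h2⟩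
  have h2 : uniformOn {S : Set α | S ⊆ V ∧ S.ncard = m} {S | (A : Set α) ⊆ S} =
      uniformOn {S : Set α | S ⊆ V ∧ S.ncard = m}
        ((((V.powersetCard m).filter fun B => A ⊆ B).image fun B : Finset α => (B : Set α) :
          Finset (Set α)) : Set (Set α)) := by
    rw [← uniformOn_inter_self (Set.toFinite _), h1]
    congr 1
    ext S
    simp only [Finset.coe_image, Set.mem_inter_iff, Set.mem_image, Finset.mem_coe,
      Finset.mem_filter, Set.mem_ofPred_eq]
    constructor
    · rintro ⟨⟨B, hB, rfl⟩, hA⟩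
      exact ⟨B, ⟨hB, by exact_mod_cast hA⟩, rfl⟩
    · rintro ⟨B, ⟨hB, hA⟩, rfl⟩
      exact ⟨⟨B, hB, rfl⟩, by exact_mod_cast hA⟩
  rw [measureReal_def, h2, h1, uniformOn_apply_finset, ENNReal.toReal_div, ENNReal.toReal_natCast,
    ENNReal.toReal_natCast, ← Finset.image_inter _ _ Finset.coe_injective,
    Finset.card_image_of_injective _ Finset.coe_injective,
    Finset.card_image_of_injective _ Finset.coe_injective, Finset.card_powersetCard,
    Finset.inter_eq_right.2 (Finset.filter_subset _ _)]

theorem descFactorial_add (n a b : ℕ) :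
    n.descFactorial (a + b) = n.descFactorial a * (n - a).descFactorial b := by
  induction b with
  | zero => simp
  | succ b ih =>
    rw [← add_assoc, Nat.descFactorial_succ, Nat.descFactorial_succ, ih, Nat.sub_sub]
    ring

/-- Factor by factor this is `(m - a - i) / (n - a - i) ≤ (m - i) / (n - i)` cleared of
denominators, which holds because `m ≤ n`. -/
theorem descFactorial_sub_mul_le {m n : ℕ} (h : m ≤ n) (a b : ℕ) :
    (m - a).descFactorial b * n.descFactorial b ≤ m.descFactorial b * (n - a).descFactorial b := by
  induction b with
  | zero => simp
  | succ b ih =>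
    have h1 : (m - a - b) * (n - b) ≤ (m - b) * (n - a - b) := by
      -- With truncated subtraction the left side vanishes once `m ≤ a + b`.
      rcases le_total m (a + b) with h0 | h0
      · simp [show m - a - b = 0 by omega]
      · obtain ⟨c, rfl⟩ := Nat.exists_eq_add_of_le h0
        obtain ⟨e, rfl⟩ := Nat.exists_eq_add_of_le h
        rw [show a + b + c - a - b = c by omega, show a + b + c + e - b = a + c + e by omega,
          show a + b + c - b = a + c by omega, show a + b + c + e - a - b = c + e by omega]
        nlinarith
    simp only [Nat.descFactorial_succ]
    calc _ = ((m - a - b) * (n - b)) * ((m - a).descFactorial b * n.descFactorial b) := by ring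
      _ ≤ ((m - b) * (n - a - b)) * (m.descFactorial b * (n - a).descFactorial b) :=
          Nat.mul_le_mul h1 ih
      _ = _ := by ring

theorem uniformOn_real_superset_eq_div [Finite α] (V : Finset α) {m : ℕ} (hm : m ≤ V.card)
    (A : Finset α) (hA : A ⊆ V) :
    (uniformOn {S : Set α | S ⊆ V ∧ S.ncard = m}).real {S | (A : Set α) ⊆ S} =
      (m.descFactorial A.card : ℝ) / V.card.descFactorial A.card := by
  classical
  rw [uniformOn_real_superset]
  have hAV := Finset.card_le_card hA
  have hn : (0 : ℝ) < V.card.choose m := by exact_mod_cast Nat.choose_pos hm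
  have hd : (0 : ℝ) < V.card.descFactorial A.card := by
    exact_mod_cast Nat.pos_of_ne_zero (mt Nat.descFactorial_eq_zero_iff_lt.1 (by omega))
  rw [div_eq_div_iff hn.ne' hd.ne']
  rcases le_or_gt A.card m with h | h
  · rw [Finset.card_filter_powersetCard_subset _ _ _ hA h]
    have h1 := Nat.choose_mul (n := V.card) h
    rw [Nat.descFactorial_eq_factorial_mul_choose, Nat.descFactorial_eq_factorial_mul_choose]
    have h2 := congrArg (Nat.cast : ℕ → ℝ) h1
    push_cast at h2 ⊢
    linear_combination (-(A.card.factorial : ℝ)) * h2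
  · rw [Nat.descFactorial_eq_zero_iff_lt.2 h]
    have : (V.powersetCard m).filter (fun B => A ⊆ B) = ∅ := by
      refine Finset.filter_eq_empty_iff.2 fun B hB hAB => ?_
      have := Finset.card_le_card hAB
      rw [(Finset.mem_powersetCard.1 hB).2] at this
      omega
    simp [this]

theorem uniformOn_real_superset_eq_zero [Finite α] (V : Finset α) (m : ℕ)
    (A : Finset α) (hA : ¬ A ⊆ V) :
    (uniformOn {S : Set α | S ⊆ V ∧ S.ncard = m}).real {S | (A : Set α) ⊆ S} = 0 := by
  classical
  rw [uniformOn_real_superset]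
  have : (V.powersetCard m).filter (fun B => A ⊆ B) = ∅ :=
    Finset.filter_eq_empty_iff.2 fun B hB hAB => hA (hAB.trans (Finset.mem_powersetCard.1 hB).1)
  simp [this]

theorem isProbabilityMeasure_uniformOn_ncard [Finite α] (V : Finset α) {m : ℕ} (hm : m ≤ V.card) :
    IsProbabilityMeasure (uniformOn {S : Set α | S ⊆ V ∧ S.ncard = m}) := by
  refine isProbabilityMeasure_uniformOn (Set.toFinite _) ?_
  obtain ⟨B, hB, hBc⟩ := Finset.exists_subset_card_eq hm
  exact ⟨B, by exact_mod_cast hB, by simpa using hBc⟩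

/-- Containment probabilities are ratios of falling factorials. Given `A ⊆ S`, the rest is a uniform
set of `m - |A|` vertices out of `n - |A|`, which is less likely to contain `B`. -/
theorem isSpread_uniformOn [Finite α] (V : Finset α) {m : ℕ} (hm : m ≤ V.card) :
    IsSpread (uniformOn {S : Set α | S ⊆ V ∧ S.ncard = m}) ((m : ℝ) / V.card) := by
  classical
  have := isProbabilityMeasure_uniformOn_ncard V hm
  refine ⟨by positivity, div_le_one_of_le₀ (by exact_mod_cast hm) (Nat.cast_nonneg _),
    fun v => ?_, fun A B hAB => ?_⟩
  · have h1 : {S : Set α | v ∈ S} = {S | (({v} : Finset α) : Set α) ⊆ S} := by ext; simp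
    rw [h1]
    by_cases hv : {v} ⊆ V
    · rw [uniformOn_real_superset_eq_div V hm _ hv]
      simp
    · rw [uniformOn_real_superset_eq_zero V m _ hv]
      positivity
  · have h1 : {S : Set α | (A : Set α) ⊆ S ∧ (B : Set α) ⊆ S} =
        {S | ((A ∪ B : Finset α) : Set α) ⊆ S} := by ext; simp [Set.union_subset_iff]
    rw [h1]
    by_cases hV : A ∪ B ⊆ V
    · have hA : A ⊆ V := Finset.subset_union_left.trans hV
      have hB : B ⊆ V := Finset.subset_union_right.trans hV
      have hc := Finset.card_le_card hV
      rw [Finset.card_union_of_disjoint hAB] at hc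
      rw [uniformOn_real_superset_eq_div V hm _ hV, uniformOn_real_superset_eq_div V hm _ hA,
        uniformOn_real_superset_eq_div V hm _ hB, Finset.card_union_of_disjoint hAB,
        descFactorial_add, descFactorial_add, Nat.cast_mul, Nat.cast_mul, mul_div_mul_comm]
      refine mul_le_mul_of_nonneg_left ?_ (by positivity)
      rw [div_le_div_iff₀]
      · exact_mod_cast descFactorial_sub_mul_le hm _ _
      · exact_mod_cast Nat.pos_of_ne_zero (mt Nat.descFactorial_eq_zero_iff_lt.1 (by omega))
      · exact_mod_cast Nat.pos_of_ne_zero (mt Nat.descFactorial_eq_zero_iff_lt.1 (by omega))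
    · rw [uniformOn_real_superset_eq_zero V m _ hV]
      exact mul_nonneg measureReal_nonneg measureReal_nonneg

end Laws

/-! ### Translation from hypergraphs to families of finsets. -/

section Hypergraphs

variable {α : Type*}

open Classical in
/-- The edges of a finite hypergraph as finsets. -/
noncomputable def edgeFinsets [Fintype α] (H : Hypergraph α) : Finset (Finset α) :=
  Finset.univ.filter fun f : Finset α => (f : Set α) ∈ H.edgeSet

theorem mem_edgeFinsets [Fintype α] {H : Hypergraph α} {f : Finset α} :
    f ∈ edgeFinsets H ↔ (f : Set α) ∈ H.edgeSet := by
  simp [edgeFinsets]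

theorem totalWeight_induce [Fintype α] (H : Hypergraph α) (w : Set α → ℝ) {w' : Finset α → ℝ}
    (hw' : ∀ f ∈ edgeFinsets H, w' f = w f) (S : Set α) :
    totalWeight w (induce H S) = ∑ f ∈ membersWithin (edgeFinsets H) S, w' f := by
  classical
  have h1 : (induce H S).edgeSet =
      (((membersWithin (edgeFinsets H) S).image fun B : Finset α => (B : Set α) :
        Finset (Set α)) : Set (Set α)) := by
    ext f
    simp only [induce, Set.mem_ofPred_eq, Finset.coe_image, Set.mem_image, Finset.mem_coe,
      mem_membersWithin, mem_edgeFinsets]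
    constructor
    · rintro ⟨h1, h2⟩
      lift f to Finset α using Set.toFinite f
      exact ⟨f, ⟨h1, h2⟩, rfl⟩
    · rintro ⟨B, h, rfl⟩
      exact h
  rw [totalWeight, h1, finsum_mem_coe_finset, Finset.sum_image fun _ _ _ _ h =>
    Finset.coe_injective h]
  exact Finset.sum_congr rfl fun f hf => (hw' f (membersWithin_subset _ _ hf)).symm

theorem card_filter_superset_le_maxDegree [Fintype α] [DecidableEq α] (H : Hypergraph α) {q : ℕ}
    (U : Finset α) (hU : U.card = q) :
    ((edgeFinsets H).filter fun f => U ⊆ f).card ≤ maxDegree H q := by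
  classical
  -- The supremum ranges only over subsets of the vertex set; any other `U` lies in no edge.
  by_cases hV : (U : Set α) ⊆ H.vertexSet
  · have h1 : ((edgeFinsets H).filter fun f => U ⊆ f).card = (edgesContaining H U).ncard := by
      rw [← Finset.card_image_of_injective _ (Finset.coe_injective (α := α)),
        ← Set.ncard_coe_finset]
      congr 1
      ext f
      simp only [Finset.coe_image, Set.mem_image, Finset.mem_coe, Finset.mem_filter,
        mem_edgeFinsets, edgesContaining, Set.mem_ofPred_eq]
      constructor
      · rintro ⟨B, ⟨h1, h2⟩, rfl⟩
        exact ⟨h1, by exact_mod_cast h2⟩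
      · rintro ⟨h1, h2⟩
        lift f to Finset α using Set.toFinite f
        exact ⟨f, ⟨h1, by exact_mod_cast h2⟩, rfl⟩
    rw [h1, maxDegree]
    exact le_ciSup (f := fun U : {U : Set α // U ⊆ H.vertexSet ∧ U.ncard = q} =>
      (edgesContaining H U.1).ncard) (Set.finite_range _).bddAbove ⟨U, hV, by simpa using hU⟩
  · have : (edgeFinsets H).filter (fun f => U ⊆ f) = ∅ := by
      refine Finset.filter_eq_empty_iff.2 fun f hf hUf => hV ?_
      exact (Finset.coe_subset.2 hUf).trans
        (H.subset_vertexSet_of_mem_edgeSet' (mem_edgeFinsets.1 hf))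
    simp [this]

end Hypergraphs

end RandomHypergraph

theorem mainTheorem11 :
    ∃ d : ℕ → ℝ, (∀ q : ℕ, 1 ≤ d q) ∧
      ∀ (k : ℕ) (D L σ Λ : ℝ), 2 ≤ k → 0 < D → 0 < L → 0 < σ → 0 < Λ →
        ∃ c : ℝ, 0 < c ∧
          ∀ (q : ℕ) (N : ℝ), 1 ≤ q → q ≤ k → 1 ≤ N →
            ∀ (α : Type*) [Finite α] (H : Hypergraph α) (w : Set α → ℝ),
              RandomHypergraph.IsUniform H k →
              (H.vertexSet.ncard : ℝ) ≤ N →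
              (RandomHypergraph.maxDegree H q : ℝ) ≤ D →
              (∀ f ∈ H.edgeSet, 0 ≤ w f ∧ w f ≤ L) →
              (∀ p : unitInterval,
                (p : ℝ) ≤ Λ * N ^ (-(((q : ℝ) - 1) / ((k : ℝ) - 1)) - σ) →
                RandomHypergraph.UpperTailBound H w
                  (RandomHypergraph.binomialLaw H p) q N c (d q)) ∧
              (∀ m : ℕ, m ≤ H.vertexSet.ncard →
                (m : ℝ) / (H.vertexSet.ncard : ℝ) ≤
                  Λ * N ^ (-(((q : ℝ) - 1) / ((k : ℝ) - 1)) - σ) →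
                RandomHypergraph.UpperTailBound H w
                  (RandomHypergraph.uniformLaw H m) q N c (d q)) := by
  classical
  refine ⟨fun _ => 3, fun _ => by norm_num, fun k D L σ Λ hk hD hL hσ hΛ => ?_⟩
  obtain ⟨c, hc, hmain⟩ := RandomHypergraph.exists_upper_tail_constant k D L σ Λ hk hD hL hσ hΛ
  refine ⟨c, hc, fun q N hq hqk hN α _ H w hunif hV hdeg hw => ?_⟩
  have := Fintype.ofFinite α
  set E := RandomHypergraph.edgeFinsets H
  -- Extension by zero makes the weights non-negative on all finsets, since `w` is controlled on
  -- edges only.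
  set w' : Finset α → ℝ := fun f => if f ∈ E then w f else 0 with hw'
  have hVc : H.vertexSet.ncard = H.vertexSet.toFinset.card := Set.ncard_eq_toFinset_card' _
  have key : ∀ (P : Measure (Set α)) [IsProbabilityMeasure P] (p : ℝ),
      RandomHypergraph.IsSpread P p →
      p ≤ Λ * N ^ (-(((q : ℝ) - 1) / ((k : ℝ) - 1)) - σ) →
      RandomHypergraph.UpperTailBound H w P q N c 3 := by
    intro P _ p hP hp t ht
    have hX := RandomHypergraph.totalWeight_induce H w (w' := w') fun f hf => if_pos hf
    simp_rw [hX, RandomHypergraph.integral_sum_membersWithin]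
    refine hmain q N hq hqk hN α P p H.vertexSet.toFinset E w' hP (fun f hf => ?_)
      (by rwa [← hVc]) (fun U hU => ?_) (fun f => ?_) (fun f hf => ?_) hp t ht
    · have hf' := RandomHypergraph.mem_edgeFinsets.1 hf
      refine ⟨?_, by simpa using hunif _ hf'⟩
      rw [← Finset.coe_subset, Set.coe_toFinset]
      exact H.subset_vertexSet_of_mem_edgeSet' hf'
    · refine le_trans ?_ hdeg
      exact_mod_cast RandomHypergraph.card_filter_superset_le_maxDegree H U hU
    · rw [hw']
      dsimp only
      split_ifs with hf
      · exact (hw _ (RandomHypergraph.mem_edgeFinsets.1 hf)).1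
      · exact le_rfl
    · rw [hw']
      dsimp only
      rw [if_pos hf]
      exact (hw _ (RandomHypergraph.mem_edgeFinsets.1 hf)).2
  refine ⟨fun p hp => ?_, fun m hm hp => ?_⟩
  · have : IsProbabilityMeasure (RandomHypergraph.binomialLaw H p) := by
      rw [RandomHypergraph.binomialLaw]; infer_instance
    exact key _ p (RandomHypergraph.isSpread_setBernoulli _ p) hp
  · have hlaw : RandomHypergraph.uniformLaw H m =
        uniformOn {S : Set α | S ⊆ H.vertexSet.toFinset ∧ S.ncard = m} := by
      rw [RandomHypergraph.uniformLaw, Set.coe_toFinset]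
    rw [hVc] at hm hp
    rw [hlaw]
    have := RandomHypergraph.isProbabilityMeasure_uniformOn_ncard _ hm
    exact key _ _ (RandomHypergraph.isSpread_uniformOn _ hm) hp
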